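/- Let $G$ be a countably infinite group and let $P=\{P_j\}_{j\ge 0}$ be a sequence of nonempty finite subsets of $G$. For a measure-preserving action $T=\{T_g\}_{g\in G}$ of $G$ on a standard probability space $(X,\mu)$ and a finite measurable partition $\xi$ of $X$ put $$h_j(T,\xi)=\frac1{|P_j|}\,H\Big(\bigvee_{p\in P_j}T_p\xi\Big),\qquad h_P(T,\xi)=\limsup_{j\to\infty}h_j(T,\xi),\qquad h_P(T)=\sup_\xi h_P(T,\xi),$$ where $H(\{C_1,\dots,C_n\})=-\sum_{i}\mu(C_i)\ln\mu(C_i)$ and the supremum is over all finite measurable partitions. A factor of $T$ is the restriction of $T$ to a $T$-invariant sub-$\sigma$-algebra, and its $P$-entropy is the supremum of $h_P(T,\xi)$ over the finite partitions $\xi$ measurable with respect to this $\sigma$-algebra. A factor is nontrivial if its $\sigma$-algebra contains a set of measure different from $0$ and $1$. The action $T$ has completely positive $P$-entropy if every nontrivial factor of $T$ has positive $P$-entropy. Let $T$ and $S$ be measure-preserving actions of $G$ on standard probability spaces $(X,\mu)$ and $(Y,\nu)$. Suppose that $T$ has completely positive $P$-entropy and that $h_P(S)=0$. Then $T$ and $S$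 are disjoint: the only Markov operator $J:L_2(X,\mu)\to L_2(Y,\nu)$ (a bounded linear operator that preserves nonnegativity and satisfies $J1=1$, $J^*1=1$) intertwining $T$ and $S$ is $f\mapsto\int f\,d\mu$. Moreover, an $S$-factor and a $T$-factor are always independent: if $R$ is a measure-preserving action of $G$ on a standard probability space $(Z,\lambda)$, and $\mathcal A$, $\mathcal B$ are $R$-invariant sub-$\sigma$-algebras such that the restriction of $R$ to $\mathcal A$ is isomorphic to $S$ and the restriction of $R$ to $\mathcal B$ is isomorphic to $T$, then $\mathcal A$ and $\mathcal B$ are independent. -/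

import Mathlib

open MeasureTheory Filter

noncomputable section

namespace PEntropy

/-! Throughout, a measure-preserving action of a group `G` on a probability space `(X, μ)` is given
by Mathlib's classes `MulAction G X`, `MeasurableConstSMul G X` and `SMulInvariantMeasure G X μ`;
the transformation `T_g` is `x ↦ g • x`. -/

/-- A finite partition of `X` is encoded by its labelling `ξ : X → ι` with `ι` finite; its cells are
the sets `ξ ⁻¹' {i}` (empty cells contribute `0` to the entropy). This is the Shannon entropy
`H(ξ) = - ∑ i, μ (C_i) * ln (μ (C_i))`. -/
def entropy {X ι : Type*} [MeasurableSpace X] [Fintype ι] (μ : Measure X) (ξ : X → ι) : ℝ :=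
  -∑ i, μ.real (ξ ⁻¹' {i}) * Real.log (μ.real (ξ ⁻¹' {i}))

/-- The partition `T_p ξ = {T_p C_1, …, T_p C_n}`: the point `x` lies in `T_p C_i` iff
`p⁻¹ • x` lies in `C_i`. -/
def translatePartition {G X ι : Type*} [Group G] [MulAction G X] (p : G) (ξ : X → ι) : X → ι :=
  fun x => ξ (p⁻¹ • x)

/-- The join `⋁ p ∈ F, T_p ξ`: two points lie in the same cell iff, for every `p ∈ F`, they
lie in the same cell of `T_p ξ`. -/
def joinTranslates {G X ι : Type*} [Group G] [MulAction G X] (F : Finset G) (ξ : X → ι) : X → (F → ι) :=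
  fun x p => translatePartition (p : G) ξ x

open Classical in
/-- `h_j(T, ξ) = (1 / |F|) * H (⋁ p ∈ F, T_p ξ)` with `F = P_j`. -/
def meanEntropy {G X : Type*} [Group G] [MulAction G X] [MeasurableSpace X] (μ : Measure X)
    (F : Finset G) {n : ℕ} (ξ : X → Fin n) : ℝ :=
  (1 / (F.card : ℝ)) * entropy μ (joinTranslates F ξ)

/-- `h_P(T, ξ) = limsup_j h_j(T, ξ)`. -/
def partitionPEntropy {G X : Type*} [Group G] [MulAction G X] [MeasurableSpace X] (μ : Measure X)
    (P : ℕ → Finset G) {n : ℕ} (ξ : X → Fin n) : EReal :=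
  limsup (fun j => ((meanEntropy μ (P j) ξ : ℝ) : EReal)) atTop

/-- The `P`-entropy of the restriction of the action to the σ-algebra `𝓕`: the supremum of
`h_P(T, ξ)` over all finite `𝓕`-measurable partitions `ξ`. -/
def factorPEntropy {G X : Type*} [Group G] [MulAction G X] (𝓕 : MeasurableSpace X)
    [MeasurableSpace X] (μ : Measure X) (P : ℕ → Finset G) : EReal :=
  ⨆ (n : ℕ) (ξ : X → Fin n) (_ : Measurable[𝓕] ξ), partitionPEntropy μ P ξ

/-- The `P`-entropy `h_P(T)` of the action: the supremum over all finite measurable partitions. -/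
def pEntropy {G X : Type*} [Group G] [MulAction G X] [mX : MeasurableSpace X] (μ : Measure X)
    (P : ℕ → Finset G) : EReal :=
  factorPEntropy mX μ P

/-- A factor of the action: a sub-σ-algebra that is invariant under the action. -/
structure IsFactor (G : Type*) {X : Type*} [Group G] [MulAction G X] (𝓕 : MeasurableSpace X)
    [mX : MeasurableSpace X] : Prop where
  le : 𝓕 ≤ mX
  invariant : ∀ (g : G) (A : Set X), MeasurableSet[𝓕] A → MeasurableSet[𝓕] ((g • ·) ⁻¹' A)

/-- A σ-algebra is nontrivial (modulo `μ`) if it contains a set whose measure is neither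
`0` nor `1`. -/
def IsNontrivialAlgebra {X : Type*} (𝓕 : MeasurableSpace X) [MeasurableSpace X]
    (μ : Measure X) : Prop :=
  ∃ A : Set X, MeasurableSet[𝓕] A ∧ μ A ≠ 0 ∧ μ A ≠ 1

/-- Completely positive `P`-entropy: every nontrivial factor has positive `P`-entropy. -/
def HasCompletelyPositivePEntropy {G X : Type*} [Group G] [MulAction G X] [mX : MeasurableSpace X]
    (μ : Measure X) (P : ℕ → Finset G) : Prop :=
  ∀ 𝓕 : MeasurableSpace X, @IsFactor G X _ _ 𝓕 mX → @IsNontrivialAlgebra X 𝓕 mX μ →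
    0 < @factorPEntropy G X _ _ 𝓕 mX μ P

/-- The restriction of the action on `(Z, lam)` to the invariant σ-algebra `𝓕` is isomorphic to the
action on `(X, μ)`. For standard spaces this means that there is a measure-preserving, almost
everywhere equivariant map `π : Z → X` such that `𝓕` coincides modulo null sets with the
σ-algebra of the sets `π ⁻¹' B`. -/
def IsFactorIsomorphicTo (G : Type*) {Z X : Type*} [Group G] (𝓕 : MeasurableSpace Z)
    [MulAction G Z] [MeasurableSpace Z] [MulAction G X] [MeasurableSpace X]
    (lam : Measure Z) (μ : Measure X) : Prop :=
  IsFactor G 𝓕 ∧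
  ∃ π : Z → X, MeasurePreserving π lam μ ∧
    (∀ g : G, ∀ᵐ z ∂lam, π (g • z) = g • π z) ∧
    (∀ A : Set Z, MeasurableSet[𝓕] A → ∃ B : Set X, MeasurableSet B ∧ A =ᵐ[lam] π ⁻¹' B) ∧
    (∀ B : Set X, MeasurableSet B → ∃ A : Set Z, MeasurableSet[𝓕] A ∧ A =ᵐ[lam] π ⁻¹' B)

/-- The Koopman operator `f ↦ f ∘ T_g` on `L²(μ)`. -/
def koopman {G X : Type*} [Group G] [MulAction G X] [MeasurableSpace X] [MeasurableConstSMul G X]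
    (μ : Measure X) [SMulInvariantMeasure G X μ] (g : G) (f : Lp ℝ 2 μ) : Lp ℝ 2 μ :=
  Lp.compMeasurePreserving (g • ·) (measurePreserving_smul g μ) f

/-- A Markov operator `J : L²(μ) → L²(ν)` intertwining the two actions: `J` preserves
nonnegativity, `J` and its adjoint fix the constants, and `J` commutes with the actions. -/
structure IsMarkovIntertwining (G : Type*) {X Y : Type*} [Group G]
    [MulAction G X] [MeasurableSpace X] [MeasurableConstSMul G X]
    [MulAction G Y] [MeasurableSpace Y] [MeasurableConstSMul G Y]
    (μ : Measure X) [IsProbabilityMeasure μ] [SMulInvariantMeasure G X μ]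
    (ν : Measure Y) [IsProbabilityMeasure ν] [SMulInvariantMeasure G Y ν]
    (J : Lp ℝ 2 μ →L[ℝ] Lp ℝ 2 ν) : Prop where
  nonneg : ∀ f : Lp ℝ 2 μ, 0 ≤ f → 0 ≤ J f
  map_one : J (Lp.const 2 μ 1) = Lp.const 2 ν 1
  adjoint_one : ContinuousLinearMap.adjoint J (Lp.const 2 ν 1) = Lp.const 2 μ 1
  intertwines : ∀ (g : G) (f : Lp ℝ 2 μ), J (koopman μ g f) = koopman ν g (J f)

/-- Disjointness: there is no nontrivial Markov intertwining, that is, the only one is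
`f ↦ ∫ f dμ`. -/
def AreDisjoint (G : Type*) {X Y : Type*} [Group G]
    [MulAction G X] [MeasurableSpace X] [MeasurableConstSMul G X]
    [MulAction G Y] [MeasurableSpace Y] [MeasurableConstSMul G Y]
    (μ : Measure X) [IsProbabilityMeasure μ] [SMulInvariantMeasure G X μ]
    (ν : Measure Y) [IsProbabilityMeasure ν] [SMulInvariantMeasure G Y ν] : Prop :=
  ∀ J : Lp ℝ 2 μ →L[ℝ] Lp ℝ 2 ν, IsMarkovIntertwining G μ ν J →
    ∀ f : Lp ℝ 2 μ, J f = Lp.const 2 ν (∫ x, f x ∂μ)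

end PEntropy

end

/-! For a Markov intertwining `J`, let `K` be its adjoint. The function `k B = K 1_B` on `X` plays
the role of the conditional probability of `B` given `x`. It suffices to show that every `k B` is
a.e. constant: testing `J f` against indicators then gives disjointness.

The translates of `k B` generate a factor of `T`, so by completely positive entropy it is enough
that this factor has zero `P`-entropy. Over each `x`, draw `N` independent samples of a finite
partition `η` of `Y` with the probabilities `k`. If `η` refines a translate of `B`, the frequency of
that translate among the samples is close to its conditional probability given `x`, by the law of
large numbers. Hence any finite partition `ξ` measurable in the factor is predicted with small error
from many samples of a fine `η` (`tendsto_predictionError_lt`, `asymptoticAlgebra`), so the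
conditional entropy of `ξ` given the samples is small (`labelled_entropy_sub_le`).

On each finite set `F`, the join of the translates of `ξ` has entropy at most `N` times that of the
join for `η`, plus `|F|` times this conditional entropy (`entropy_joinTranslates_le`). Divide by
`|F|`, with `N` and `η` fixed: the first term vanishes in the limit because `h_P(S) = 0`, and the
second is arbitrarily small.

Independence follows by composing the lift from `X` to the large space with the adjoint of the lift
from `Y`: this is a Markov intertwining, hence trivial. -/

namespace PEntropy

/-! ### Shannon entropy inequalities -/

section Entropy

open Real

lemma negMulLog_sum_le {α : Type*} (s : Finset α) (p : α → ℝ) (hp : ∀ a ∈ s, 0 ≤ p a) :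
    negMulLog (∑ a ∈ s, p a) ≤ ∑ a ∈ s, negMulLog (p a) := by
  simp only [negMulLog]
  rw [neg_mul, Finset.sum_mul, ← Finset.sum_neg_distrib]
  refine Finset.sum_le_sum fun a ha => ?_
  rcases (hp a ha).eq_or_lt with h | h
  · simp [← h]
  · rw [neg_mul]
    have := log_le_log h (Finset.single_le_sum hp ha)
    nlinarith

/-- Gibbs' inequality: `a i j` is compared with the product array `r i * c j / t`, which has the
same total mass. No normalisation is imposed, so that the bound applies inside a single cell of a
conditioning partition. -/
lemma negMulLog_submodular {α β : Type*} [Fintype α] [Fintype β] (a : α → β → ℝ)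
    (ha : ∀ i j, 0 ≤ a i j) :
    ∑ i, ∑ j, negMulLog (a i j) + negMulLog (∑ i, ∑ j, a i j) ≤
      ∑ i, negMulLog (∑ j, a i j) + ∑ j, negMulLog (∑ i, a i j) := by
  set r : α → ℝ := fun i => ∑ j, a i j with hr
  set c : β → ℝ := fun j => ∑ i, a i j with hc
  set t : ℝ := ∑ i, r i with ht
  have htc : ∑ j, c j = t := Finset.sum_comm
  have hr0 : ∀ i, 0 ≤ r i := fun i => Finset.sum_nonneg fun j _ => ha i j
  have hc0 : ∀ j, 0 ≤ c j := fun j => Finset.sum_nonneg fun i _ => ha i j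
  have ht0 : 0 ≤ t := Finset.sum_nonneg fun i _ => hr0 i
  have key : ∀ i j, a i j - r i * c j / t ≤
      a i j * log (a i j) + a i j * log t - a i j * log (r i) - a i j * log (c j) := by
    intro i j
    rcases (ha i j).eq_or_lt with h | h
    · rw [← h]
      have : 0 ≤ r i * c j / t := div_nonneg (mul_nonneg (hr0 i) (hc0 j)) ht0
      simpa using this
    · have h1 : 0 < r i := h.trans_le
        (Finset.single_le_sum (f := fun j => a i j) (fun j _ => ha i j) (Finset.mem_univ j))
      have h2 : 0 < c j := h.trans_le
        (Finset.single_le_sum (f := fun i => a i j) (fun i _ => ha i j) (Finset.mem_univ i))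
      have h3 : 0 < t := h1.trans_le
        (Finset.single_le_sum (fun i _ => hr0 i) (Finset.mem_univ i))
      have h4 := log_le_sub_one_of_pos (x := r i * c j / (t * a i j)) (by positivity)
      rw [log_div (by positivity) (by positivity), log_mul h1.ne' h2.ne',
        log_mul h3.ne' h.ne'] at h4
      have h5 := mul_le_mul_of_nonneg_left h4 h.le
      have h6 : a i j * (r i * c j / (t * a i j) - 1) = r i * c j / t - a i j := by
        field_simp
      linarith
  have hsum := Finset.sum_le_sum fun i (_ : i ∈ Finset.univ) =>
    Finset.sum_le_sum fun j (_ : j ∈ Finset.univ) => key i j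
  have hl : ∑ i, ∑ j, (a i j - r i * c j / t) = 0 := by
    simp only [Finset.sum_sub_distrib, ← Finset.sum_div, ← Finset.mul_sum, htc, ← Finset.sum_mul]
    -- The identity `t * t / t = t` also covers `t = 0`, where division returns `0`.
    rw [← ht, mul_self_div_self, sub_self]
  have e1 : ∑ i, ∑ j, a i j * log t = t * log t := by
    simp only [← Finset.sum_mul]; rfl
  have e2 : ∑ i, ∑ j, a i j * log (r i) = ∑ i, r i * log (r i) := by
    simp only [← Finset.sum_mul]; rfl
  have e3 : ∑ i, ∑ j, a i j * log (c j) = ∑ j, c j * log (c j) := by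
    rw [Finset.sum_comm]; simp only [← Finset.sum_mul]; rfl
  rw [hl] at hsum
  simp only [Finset.sum_sub_distrib, Finset.sum_add_distrib, e1, e2, e3] at hsum
  simp only [negMulLog, neg_mul, Finset.sum_neg_distrib]
  linarith

variable {Ω α β γ : Type*} [MeasurableSpace Ω] {ρ : Measure Ω}
  [Fintype α] [MeasurableSpace α] [MeasurableSingletonClass α]
  [Fintype β] [MeasurableSpace β] [MeasurableSingletonClass β]
  [Fintype γ] [MeasurableSpace γ] [MeasurableSingletonClass γ]

lemma entropy_eq_sum_negMulLog {ι : Type*} [Fintype ι] (ξ : Ω → ι) :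
    entropy ρ ξ = ∑ i, negMulLog (ρ.real (ξ ⁻¹' {i})) := by
  simp [entropy, negMulLog]

lemma entropy_map {Ω' : Type*} [MeasurableSpace Ω'] {T : Ω → Ω'} (hT : Measurable T)
    {f : Ω' → α} (hf : Measurable f) : entropy (ρ.map T) f = entropy ρ (f ∘ T) := by
  simp only [entropy, Set.preimage_comp]
  congr 2 with i
  rw [map_measureReal_apply hT (hf (measurableSet_singleton i))]

lemma measureReal_comp_preimage [IsFiniteMeasure ρ] {ι : Type*} [DecidableEq ι] {g : Ω → α}
    (hg : Measurable g) (φ : α → ι) (b : ι) :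
    ρ.real ((φ ∘ g) ⁻¹' {b}) = ∑ a with φ a = b, ρ.real (g ⁻¹' {a}) := by
  rw [sum_measureReal_preimage_singleton]
  · congr 1; ext; simp
  · exact fun y _ => hg (measurableSet_singleton y)

lemma entropy_comp_le [IsFiniteMeasure ρ] {ι : Type*} [Fintype ι] {g : Ω → α} (hg : Measurable g)
    (φ : α → ι) :
    entropy ρ (φ ∘ g) ≤ entropy ρ g := by
  classical
  simp only [entropy_eq_sum_negMulLog]
  rw [← Finset.sum_fiberwise (s := Finset.univ) (g := φ)]
  refine Finset.sum_le_sum fun b _ => ?_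
  rw [measureReal_comp_preimage hg]
  exact negMulLog_sum_le _ _ fun a _ => measureReal_nonneg

lemma entropy_le_of_determined [IsProbabilityMeasure ρ] {ι : Type*} [Fintype ι] {f : Ω → ι}
    {g : Ω → α} (hg : Measurable g) (h : ∀ ω ω', g ω = g ω' → f ω = f ω') : entropy ρ f ≤ entropy ρ g := by
  have : Nonempty Ω := nonempty_of_isProbabilityMeasure ρ
  have hf : Function.extend g f (fun _ => f (Classical.arbitrary Ω)) ∘ g = f :=
    Function.FactorsThrough.extend_comp _ fun ω ω' hω => h ω ω' hω
  rw [← hf]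
  exact entropy_comp_le hg _

/-- This is `H(f, g | h) ≤ H(f | h) + H(g | h)` without subtraction; it is `negMulLog_submodular` in
each cell of `h`. -/
lemma entropy_submodular [IsFiniteMeasure ρ] {f : Ω → α} {g : Ω → β} {h : Ω → γ}
    (hf : Measurable f) (hg : Measurable g) (hh : Measurable h) :
    entropy ρ (fun ω => (h ω, f ω, g ω)) + entropy ρ h ≤
      entropy ρ (fun ω => (h ω, f ω)) + entropy ρ (fun ω => (h ω, g ω)) := by
  classical
  simp only [entropy_eq_sum_negMulLog, Fintype.sum_prod_type, ← Finset.sum_add_distrib]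
  refine Finset.sum_le_sum fun c _ => ?_
  have hm : Measurable fun ω => (h ω, f ω, g ω) := by fun_prop
  have e1 : ρ.real (h ⁻¹' {c}) =
      ∑ a, ∑ b, ρ.real ((fun ω => (h ω, f ω, g ω)) ⁻¹' {(c, a, b)}) := by
    rw [show h = Prod.fst ∘ fun ω => (h ω, f ω, g ω) from rfl, measureReal_comp_preimage hm,
      Finset.sum_filter, Fintype.sum_prod_type, Finset.sum_eq_single c (by simp +contextual)
      (by simp), Fintype.sum_prod_type]
    simp
  have e2 : ∀ a, ρ.real ((fun ω => (h ω, f ω)) ⁻¹' {(c, a)}) =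
      ∑ b, ρ.real ((fun ω => (h ω, f ω, g ω)) ⁻¹' {(c, a, b)}) := by
    intro a
    rw [show (fun ω => (h ω, f ω)) = (fun q : γ × α × β => (q.1, q.2.1)) ∘
      fun ω => (h ω, f ω, g ω) from rfl, measureReal_comp_preimage hm,
      Finset.sum_filter, Fintype.sum_prod_type, Finset.sum_eq_single c (by simp +contextual)
      (by simp), Fintype.sum_prod_type, Finset.sum_eq_single a (by simp +contextual) (by simp)]
    simp
  have e3 : ∀ b, ρ.real ((fun ω => (h ω, g ω)) ⁻¹' {(c, b)}) =
      ∑ a, ρ.real ((fun ω => (h ω, f ω, g ω)) ⁻¹' {(c, a, b)}) := by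
    intro b
    rw [show (fun ω => (h ω, g ω)) = (fun q : γ × α × β => (q.1, q.2.2)) ∘
      fun ω => (h ω, f ω, g ω) from rfl, measureReal_comp_preimage hm,
      Finset.sum_filter, Fintype.sum_prod_type, Finset.sum_eq_single c (by simp +contextual)
      (by simp), Fintype.sum_prod_type_right, Finset.sum_eq_single b (by simp +contextual) (by simp)]
    simp
  rw [e1]
  simp only [e2, e3]
  exact negMulLog_submodular _ fun _ _ => measureReal_nonneg

/-- `H(K ∨ ⋁ p, I p) ≤ H(K) + ∑ p, H(I p | Z p)` when every `Z p` is a function of `K`. -/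
lemma entropy_prod_pi_le [IsProbabilityMeasure ρ] {F : Type*} [Fintype F] [DecidableEq F]
    {I : F → Ω → α} (hI : ∀ p, Measurable (I p)) {K : Ω → β} (hK : Measurable K)
    {Z : F → Ω → γ} (hZ : ∀ p, Measurable (Z p))
    (hKZ : ∀ p ω ω', K ω = K ω' → Z p ω = Z p ω') :
    entropy ρ (fun ω => (K ω, fun p => I p ω)) ≤ entropy ρ K +
      ∑ p, (entropy ρ (fun ω => (Z p ω, I p ω)) - entropy ρ (Z p)) := by
  obtain ⟨ω₀⟩ : Nonempty Ω := nonempty_of_isProbabilityMeasure ρ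
  -- Coordinates are added one at a time. Those outside `S` are frozen at their value at `ω₀`, so
  -- that the target type does not depend on `S`. The step for `q` is submodularity conditioned on
  -- `Z q`, which `K` determines.
  have key : ∀ S : Finset F,
      entropy ρ (fun ω => (K ω, fun p => if p ∈ S then I p ω else I p ω₀)) ≤ entropy ρ K +
        ∑ p ∈ S, (entropy ρ (fun ω => (Z p ω, I p ω)) - entropy ρ (Z p)) := by
    intro S
    have hIS : ∀ S : Finset F, Measurable fun ω => fun p => if p ∈ S then I p ω else I p ω₀ := by
      intro S
      refine measurable_pi_lambda _ fun p => ?_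
      split_ifs
      exacts [hI p, measurable_const]
    induction S using Finset.induction_on with
    | empty =>
      simp only [Finset.sum_empty, add_zero]
      exact entropy_le_of_determined hK fun ω ω' h => by simp [h]
    | insert q S hq ih =>
      rw [Finset.sum_insert hq]
      have h1 := entropy_submodular (ρ := ρ) (hI q) (hK.prodMk (hIS S)) (hZ q)
      have h2 : entropy ρ (fun ω => (Z q ω, K ω, fun p => if p ∈ S then I p ω else I p ω₀)) ≤
          entropy ρ (fun ω => (K ω, fun p => if p ∈ S then I p ω else I p ω₀)) :=
        entropy_le_of_determined (hK.prodMk (hIS S)) fun ω ω' h => by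
          simp only [Prod.mk.injEq] at h ⊢
          exact ⟨hKZ q _ _ h.1, h⟩
      have h3 : entropy ρ (fun ω => (K ω, fun p => if p ∈ insert q S then I p ω else I p ω₀)) ≤
          entropy ρ (fun ω => (Z q ω, I q ω, K ω, fun p => if p ∈ S then I p ω else I p ω₀)) :=
        entropy_le_of_determined ((hZ q).prodMk ((hI q).prodMk (hK.prodMk (hIS S))))
          fun ω ω' h => by
            simp only [Prod.mk.injEq] at h ⊢
            refine ⟨h.2.2.1, funext fun p => ?_⟩
            have := congrFun h.2.2.2 p
            by_cases hp : p = q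
            · subst hp; simpa using h.2.1
            · simpa [hp] using this
      linarith
  simpa using key Finset.univ

lemma entropy_pi_le_sum [IsProbabilityMeasure ρ] {F : Type*} [Fintype F] [DecidableEq F]
    {I : F → Ω → α} (hI : ∀ p, Measurable (I p)) :
    entropy ρ (fun ω p => I p ω) ≤ ∑ p, entropy ρ (I p) := by
  have h := entropy_prod_pi_le (ρ := ρ) hI (K := fun _ => ()) measurable_const
    (Z := fun _ _ => ()) (fun _ => measurable_const) (fun _ _ _ _ => rfl)
  have h0 : entropy ρ (fun _ : Ω => ()) = 0 := by simp [entropy]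
  have h1 : ∀ p, entropy ρ (fun ω => ((), I p ω)) ≤ entropy ρ (I p) := fun p =>
    entropy_le_of_determined (hI p) fun ω ω' h => by simp [h]
  have h2 : entropy ρ (fun ω p => I p ω) ≤ entropy ρ (fun ω => ((), fun p => I p ω)) :=
    entropy_le_of_determined (by fun_prop) fun ω ω' h => by simpa using h
  have h3 := Finset.sum_le_sum fun p (_ : p ∈ Finset.univ) => h1 p
  simp only [h0, sub_zero, zero_add] at h
  linarith

/-- Condition on the whole array `Z`: its entropy splits over the rows `m`, while each `I p` needs
only the column `p`. Rows will be samples and columns group elements. -/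
lemma entropy_pi_le [IsProbabilityMeasure ρ] {F M : Type*} [Fintype F] [DecidableEq F]
    [Fintype M] [DecidableEq M] {I : F → Ω → α} (hI : ∀ p, Measurable (I p))
    {Z : M → F → Ω → β} (hZ : ∀ m p, Measurable (Z m p)) :
    entropy ρ (fun ω p => I p ω) ≤ ∑ m, entropy ρ (fun ω p => Z m p ω) +
      ∑ p, (entropy ρ (fun ω => (fun m => Z m p ω, I p ω)) - entropy ρ (fun ω m => Z m p ω)) := by
  have h1 := entropy_prod_pi_le (ρ := ρ) hI (K := fun ω m p => Z m p ω) (by fun_prop)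
    (Z := fun p ω m => Z m p ω) (by fun_prop)
    (fun p ω ω' h => funext fun m => congrFun (congrFun h m) p)
  have h2 := entropy_pi_le_sum (ρ := ρ) (I := fun m ω p => Z m p ω) (by fun_prop)
  have h3 : entropy ρ (fun ω p => I p ω) ≤
      entropy ρ (fun ω => (fun m p => Z m p ω, fun p => I p ω)) :=
    entropy_le_of_determined (by fun_prop) fun ω ω' h => (Prod.mk.inj h).2
  linarith

end Entropy

end PEntropy

/-! ### Predicting sets from the label of a decomposed measure -/

namespace PEntropy

open scoped ENNReal Topology
open Real (negMulLog)

section Decomposition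

variable {X κ κ' : Type*} [MeasurableSpace X] [Fintype κ] [Fintype κ']

/-- The error of the best prediction of `A` from the label in a decomposition `∑ c, m c` of a
measure. -/
noncomputable def predictionError (m : κ → Measure X) (A : Set X) : ℝ≥0∞ :=
  ∑ c, min (m c A) (m c Aᶜ)

lemma predictionError_empty (m : κ → Measure X) : predictionError m ∅ = 0 := by
  simp [predictionError]

lemma predictionError_compl (m : κ → Measure X) (A : Set X) :
    predictionError m Aᶜ = predictionError m A := by
  simp [predictionError, min_comm]

/-- In each cell, predict membership in the union unless non-membership is the better guess for `A`
or for `B`. -/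
lemma predictionError_union_le (m : κ → Measure X) (A B : Set X) :
    predictionError m (A ∪ B) ≤ predictionError m A + predictionError m B := by
  rw [predictionError, predictionError, predictionError, ← Finset.sum_add_distrib]
  refine Finset.sum_le_sum fun c _ => ?_
  have hu := measure_union_le (μ := m c) A B
  have hA : m c (A ∪ B)ᶜ ≤ m c Aᶜ := measure_mono (by gcongr; exact Set.subset_union_left)
  have hB : m c (A ∪ B)ᶜ ≤ m c Bᶜ := measure_mono (by gcongr; exact Set.subset_union_right)
  rcases min_choice (m c A) (m c Aᶜ) with h | h
  · rcases min_choice (m c B) (m c Bᶜ) with h' | h'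
    · rw [h, h']; exact (min_le_left _ _).trans hu
    · rw [h']; exact (min_le_right _ _).trans (hB.trans le_add_self)
  · rw [h]; exact (min_le_right _ _).trans (hA.trans le_self_add)

lemma predictionError_le_add_diff {μ : Measure X} {m : κ → Measure X} (hm : ∑ c, m c = μ)
    {A B : Set X} (hAB : A ⊆ B) :
    predictionError m B ≤ predictionError m A + μ (B \ A) := by
  rw [predictionError, predictionError, ← hm, Measure.finsetSum_apply, ← Finset.sum_add_distrib]
  refine Finset.sum_le_sum fun c _ => ?_
  have h1 : m c B ≤ m c A + m c (B \ A) := by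
    refine (measure_mono ?_).trans (measure_union_le _ _)
    rw [Set.union_sdiff_cancel hAB]
  have h2 : m c Bᶜ ≤ m c Aᶜ + m c (B \ A) :=
    (measure_mono (Set.compl_subset_compl.2 hAB)).trans le_self_add
  rw [← min_add_add_right]
  exact min_le_min h1 h2

lemma predictionError_congr {μ : Measure X} {m : κ → Measure X} (hm : ∑ c, m c = μ)
    {A B : Set X} (hAB : A =ᵐ[μ] B) : predictionError m A = predictionError m B := by
  have hc : ∀ c, m c ≪ μ := fun c => by
    rw [← hm]
    refine Measure.absolutelyContinuous_of_le fun s => ?_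
    rw [Measure.finsetSum_apply]
    exact Finset.single_le_sum (f := fun c => m c s) (fun _ _ => zero_le) (Finset.mem_univ c)
  simp only [predictionError]
  refine Finset.sum_congr rfl fun c _ => ?_
  rw [measure_congr ((hc c).ae_eq hAB), measure_congr ((hc c).ae_eq hAB.compl)]

/-- The sets that are asymptotically predictable along a sequence of decompositions. -/
@[reducible]
def asymptoticAlgebra {lab : ℕ → Type*} [∀ n, Fintype (lab n)] (μ : Measure X) [IsFiniteMeasure μ]
    (m : ∀ n, lab n → Measure X) (hm : ∀ n, ∑ c, m n c = μ) : MeasurableSpace X where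
  MeasurableSet' A := MeasurableSet A ∧ Tendsto (fun n => predictionError (m n) A) atTop (𝓝 0)
  measurableSet_empty := ⟨.empty, by simp [predictionError_empty]⟩
  measurableSet_compl A hA := ⟨hA.1.compl, by simpa only [predictionError_compl] using hA.2⟩
  measurableSet_iUnion A hA := by
    refine ⟨.iUnion fun i => (hA i).1, ?_⟩
    have hacc : ∀ M, Tendsto (fun n => predictionError (m n) (Set.accumulate A M)) atTop (𝓝 0) := by
      intro M
      induction M with
      | zero => simpa using (hA 0).2
      | succ M ih =>
        rw [Set.accumulate_succ]
        exact tendsto_of_tendsto_of_tendsto_of_le_of_le tendsto_const_nhds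
          (by simpa using ih.add (hA (M + 1)).2) (fun _ => zero_le)
          (fun n => predictionError_union_le _ _ _)
    -- The tail of the union costs at most its `μ`-measure, uniformly in `n`; so `M` can be fixed
    -- before `n` tends to infinity.
    have hrest : Tendsto (fun M => μ ((⋃ i, A i) \ Set.accumulate A M)) atTop (𝓝 0) := by
      have := tendsto_measure_iInter_atTop (μ := μ)
        (s := fun M => (⋃ i, A i) \ Set.accumulate A M)
        (fun M => ((MeasurableSet.iUnion fun i => (hA i).1).diff
          (.biUnion (Set.to_countable _) fun i _ => (hA i).1)).nullMeasurableSet)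
        (fun M N h => Set.sdiff_subset_sdiff_right (Set.monotone_accumulate h))
        ⟨0, measure_ne_top _ _⟩
      rwa [← Set.sdiff_iUnion, Set.iUnion_accumulate, Set.sdiff_self, measure_empty] at this
    rw [ENNReal.tendsto_nhds_zero]
    intro ε hε
    obtain ⟨M, hM⟩ := ((ENNReal.tendsto_nhds_zero.1 hrest) (ε / 2) (ENNReal.half_pos hε.ne')).exists
    filter_upwards [(ENNReal.tendsto_nhds_zero.1 (hacc M)) (ε / 2) (ENNReal.half_pos hε.ne')]
      with n hn
    calc predictionError (m n) (⋃ i, A i)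
        ≤ predictionError (m n) (Set.accumulate A M) + μ ((⋃ i, A i) \ Set.accumulate A M) :=
          predictionError_le_add_diff (hm n) (Set.accumulate_subset_iUnion M)
      _ ≤ ε / 2 + ε / 2 := add_le_add hn hM
      _ = ε := ENNReal.add_halves ε

variable [MeasurableSpace κ] [MeasurableSpace κ']

/-- The measure `∑ c, m c` on `X`, with the label `c` remembered. -/
noncomputable def labelled (m : κ → Measure X) : Measure (X × κ) :=
  ∑ c, (m c).map fun x => (x, c)

lemma labelled_apply (m : κ → Measure X) {S : Set (X × κ)} (hS : MeasurableSet S) :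
    labelled m S = ∑ c, m c {x | (x, c) ∈ S} := by
  rw [labelled, Measure.finsetSum_apply]
  refine Finset.sum_congr rfl fun c _ => ?_
  rw [Measure.map_apply (by fun_prop) hS]
  rfl

lemma labelled_map_fst (m : κ → Measure X) : (labelled m).map Prod.fst = ∑ c, m c := by
  ext A hA
  rw [Measure.map_apply measurable_fst hA, labelled_apply _ (measurable_fst hA),
    Measure.finsetSum_apply]
  rfl

lemma isProbabilityMeasure_labelled {μ : Measure X} [IsProbabilityMeasure μ] {m : κ → Measure X}
    (hm : ∑ c, m c = μ) : IsProbabilityMeasure (labelled m) := by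
  refine ⟨?_⟩
  rw [labelled_apply _ .univ, ← measure_univ (μ := μ), ← hm, Measure.finsetSum_apply]
  rfl

lemma labelled_map [MeasurableSingletonClass κ] [DecidableEq κ'] (m : κ → Measure X) {T : X → X} (hT : Measurable T)
    (φ : κ → κ') :
    (labelled m).map (Prod.map T φ) = labelled fun c' => ∑ c with φ c = c', (m c).map T := by
  have hφ : Measurable φ := measurable_of_finite φ
  ext S hS
  rw [Measure.map_apply (hT.prodMap hφ) hS, labelled_apply _ (hT.prodMap hφ hS),
    labelled_apply _ hS, ← Finset.sum_fiberwise (s := Finset.univ) (g := φ)]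
  refine Finset.sum_congr rfl fun c' _ => ?_
  rw [Measure.finsetSum_apply]
  refine Finset.sum_congr rfl fun c hc => ?_
  have hS' : MeasurableSet {x | (x, c') ∈ S} := (by fun_prop : Measurable fun x => (x, c')) hS
  rw [Measure.map_apply hT hS', ← (Finset.mem_filter.1 hc).2]
  rfl

/-- The left side is `a log (p / a)`, one term of a conditional entropy. Use `log x ≤ x - 1` with `x
= ε p / a` when `a` is the smaller part and with `x = p / a` when `p - a` is. -/
lemma mul_log_sub_le {ε a p : ℝ} (hε : 0 < ε) (ha : 0 ≤ a) (hap : a ≤ p) :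
    negMulLog a + a * Real.log p ≤ ε * p + max 1 (-Real.log ε) * min a (p - a) := by
  have hC1 : 1 ≤ max 1 (-Real.log ε) := le_max_left _ _
  have hC2 : -Real.log ε ≤ max 1 (-Real.log ε) := le_max_right _ _
  set C := max 1 (-Real.log ε)
  rcases ha.eq_or_lt with rfl | h
  · rw [min_eq_left (by linarith)]
    simp only [Real.negMulLog_zero, zero_mul, mul_zero, add_zero]
    positivity
  have hp : 0 < p := h.trans_le hap
  rw [negMulLog]
  rcases min_choice a (p - a) with hm | hm <;> rw [hm]
  · have h1 := Real.log_le_sub_one_of_pos (x := ε * p / a) (by positivity)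
    rw [Real.log_div (by positivity) h.ne', Real.log_mul hε.ne' hp.ne'] at h1
    have h2 := mul_le_mul_of_nonneg_left h1 h.le
    have h3 : a * (ε * p / a - 1) = ε * p - a := by field_simp
    have h4 := mul_le_mul_of_nonneg_right hC2 h.le
    nlinarith
  · have h1 := Real.log_le_sub_one_of_pos (x := p / a) (by positivity)
    rw [Real.log_div hp.ne' h.ne'] at h1
    have h2 := mul_le_mul_of_nonneg_left h1 h.le
    have h3 : a * (p / a - 1) = p - a := by field_simp
    have h4 := mul_le_mul_of_nonneg_right hC1 (sub_nonneg.2 hap)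
    have h5 : 0 < ε * p := by positivity
    linarith

/-- A Fano-type bound for the conditional entropy of `ξ` given the label: sum `mul_log_sub_le` over
labels and cells. The term `r * ε` arises because the label masses add up to `1`. -/
lemma labelled_entropy_sub_le [MeasurableSingletonClass κ] {μ : Measure X} [IsProbabilityMeasure μ] {m : κ → Measure X}
    (hm : ∑ c, m c = μ) {r : ℕ} {ξ : X → Fin r} (hξ : Measurable ξ) {ε : ℝ} (hε : 0 < ε) :
    entropy (labelled m) (fun ω => (ω.2, ξ ω.1)) - entropy (labelled m) Prod.snd ≤
      r * ε + max 1 (-Real.log ε) * ∑ i, (predictionError m (ξ ⁻¹' {i})).toReal := by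
  have hfin : ∀ c, IsFiniteMeasure (m c) := fun c => by
    refine ⟨lt_of_le_of_lt ?_ (measure_lt_top μ Set.univ)⟩
    rw [← hm, Measure.finsetSum_apply]
    exact Finset.single_le_sum (f := fun c => m c Set.univ) (fun _ _ => zero_le)
      (Finset.mem_univ c)
  have h1 : ∀ c i, (labelled m).real ((fun ω : X × κ => (ω.2, ξ ω.1)) ⁻¹' {(c, i)}) =
      (m c).real (ξ ⁻¹' {i}) := by
    intro c i
    rw [measureReal_def, labelled_apply _ ((by fun_prop :
      Measurable fun ω : X × κ => (ω.2, ξ ω.1)) (measurableSet_singleton _)),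
      Finset.sum_eq_single c (fun c' _ h => by simp [h]) (by simp)]
    simp only [measureReal_def]
    congr 2
    ext; simp
  have h2 : ∀ c, (labelled m).real (Prod.snd ⁻¹' {c}) = (m c).real Set.univ := by
    intro c
    rw [measureReal_def, labelled_apply _ (measurable_snd (measurableSet_singleton c)),
      Finset.sum_eq_single c (fun c' _ h => by simp [h]) (by simp)]
    simp only [measureReal_def]
    congr 2
    ext; simp
  have h3 : ∀ c, ∑ i, (m c).real (ξ ⁻¹' {i}) = (m c).real Set.univ := fun c => by
    rw [sum_measureReal_preimage_singleton _ fun i _ => hξ (measurableSet_singleton i)]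
    congr 1; ext; simp
  have h4 : ∑ c, (m c).real Set.univ = 1 := by
    simp only [measureReal_def]
    rw [← ENNReal.toReal_sum fun c _ => measure_ne_top _ _, ← Measure.finsetSum_apply, hm]
    simp
  have h5 : ∀ i, (predictionError m (ξ ⁻¹' {i})).toReal =
      ∑ c, min ((m c).real (ξ ⁻¹' {i})) ((m c).real Set.univ - (m c).real (ξ ⁻¹' {i})) := by
    intro i
    rw [predictionError, ENNReal.toReal_sum fun c _ =>
      ((min_le_left _ _).trans_lt (measure_lt_top _ _)).ne]
    refine Finset.sum_congr rfl fun c _ => ?_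
    rw [ENNReal.toReal_min (measure_ne_top _ _) (measure_ne_top _ _),
      ← measureReal_compl (hξ (measurableSet_singleton i))]
    rfl
  simp only [entropy_eq_sum_negMulLog, Fintype.sum_prod_type, h1, h2, h5]
  rw [← Finset.sum_sub_distrib, Finset.sum_comm, Finset.mul_sum]
  calc ∑ c, (∑ i, negMulLog ((m c).real (ξ ⁻¹' {i})) - negMulLog ((m c).real Set.univ))
      = ∑ c, ∑ i, (negMulLog ((m c).real (ξ ⁻¹' {i})) +
          (m c).real (ξ ⁻¹' {i}) * Real.log ((m c).real Set.univ)) := by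
        refine Finset.sum_congr rfl fun c _ => ?_
        rw [Finset.sum_add_distrib, ← Finset.sum_mul, h3, negMulLog]
        ring
    _ ≤ ∑ c, ∑ i, (ε * (m c).real Set.univ + max 1 (-Real.log ε) *
          min ((m c).real (ξ ⁻¹' {i})) ((m c).real Set.univ - (m c).real (ξ ⁻¹' {i}))) :=
        Finset.sum_le_sum fun c _ => Finset.sum_le_sum fun i _ =>
          mul_log_sub_le hε measureReal_nonneg (measureReal_mono (Set.subset_univ _))
    _ = r * ε + ∑ c, max 1 (-Real.log ε) * ∑ i,
          min ((m c).real (ξ ⁻¹' {i})) ((m c).real Set.univ - (m c).real (ξ ⁻¹' {i})) := by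
        simp only [Finset.sum_add_distrib, ← Finset.mul_sum, Finset.sum_const, Finset.card_univ,
          Fintype.card_fin, h4, mul_one, nsmul_eq_mul]
        ring

end Decomposition

end PEntropy

/-! ### Markov families and independent sampling over `X` -/

namespace PEntropy

open scoped ENNReal Topology

/-- A version `k B` of the images `K 1_B` of indicators under an equivariant Markov operator
`K : L²(ν) → L²(μ)`. -/
structure IsMarkovFamily (G : Type*) {X Y : Type*} [Group G]
    [MulAction G X] [MeasurableSpace X] [MulAction G Y] [MeasurableSpace Y]
    (μ : Measure X) (ν : Measure Y) (k : Set Y → X → ℝ) : Prop where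
  measurable : ∀ B, Measurable (k B)
  nonneg : ∀ B, MeasurableSet B → ∀ᵐ x ∂μ, 0 ≤ k B x
  union : ∀ B C, MeasurableSet B → MeasurableSet C → Disjoint B C →
    ∀ᵐ x ∂μ, k (B ∪ C) x = k B x + k C x
  univ : ∀ᵐ x ∂μ, k Set.univ x = 1
  integral : ∀ B, MeasurableSet B → ∫ x, k B x ∂μ = ν.real B
  smul : ∀ (g : G) (B : Set Y), MeasurableSet B →
    ∀ᵐ x ∂μ, k ((g • ·) ⁻¹' B) x = k B (g • x)

section Sampling

variable {G X Y κ κ' : Type*} [Group G]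
  [MulAction G X] [MeasurableSpace X] [MulAction G Y] [MeasurableSpace Y]
  {μ : Measure X} {ν : Measure Y} {k : Set Y → X → ℝ}

/-- The law, over the point `x`, of `N` independent samples of `θ`, with density in `x`. -/
noncomputable def sampleMeasure (μ : Measure X) (k : Set Y → X → ℝ) (θ : Y → κ) {N : ℕ}
    (c : Fin N → κ) : Measure X :=
  μ.withDensity fun x => ENNReal.ofReal (∏ m, k (θ ⁻¹' {c m}) x)

namespace IsMarkovFamily

lemma empty (h : IsMarkovFamily G μ ν k) : ∀ᵐ x ∂μ, k ∅ x = 0 := by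
  filter_upwards [h.union ∅ ∅ .empty .empty disjoint_bot_left] with x hx
  simpa using hx

lemma sum_preimage [MeasurableSpace κ] [MeasurableSingletonClass κ] (h : IsMarkovFamily G μ ν k)
    {θ : Y → κ} (hθ : Measurable θ) (t : Finset κ) :
    ∀ᵐ x ∂μ, ∑ c ∈ t, k (θ ⁻¹' {c}) x = k (θ ⁻¹' t) x := by
  classical
  induction t using Finset.induction_on with
  | empty => filter_upwards [h.empty] with x hx; simp [hx]
  | insert a t ha ih =>
    filter_upwards [ih, h.union (θ ⁻¹' {a}) (θ ⁻¹' t) (hθ (measurableSet_singleton a))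
      (hθ t.measurableSet) (Disjoint.preimage _ (by simpa using ha))] with x h1 h2
    rw [Finset.sum_insert ha, h1, ← h2, Finset.coe_insert, Set.insert_eq, Set.preimage_union]

lemma weights [Fintype κ] [MeasurableSpace κ] [MeasurableSingletonClass κ]
    (h : IsMarkovFamily G μ ν k) {θ : Y → κ} (hθ : Measurable θ) :
    ∀ᵐ x ∂μ, (∀ c, 0 ≤ k (θ ⁻¹' {c}) x) ∧ ∑ c, k (θ ⁻¹' {c}) x = 1 := by
  filter_upwards [h.sum_preimage hθ Finset.univ, h.univ,
    ae_all_iff.2 fun c => h.nonneg (θ ⁻¹' {c}) (hθ (measurableSet_singleton c))] with x h1 h2 h3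
  refine ⟨h3, ?_⟩
  rw [h1, ← h2]
  simp

lemma measurable_weight (h : IsMarkovFamily G μ ν k) (θ : Y → κ) {N : ℕ} (c : Fin N → κ) :
    Measurable fun x => ENNReal.ofReal (∏ m, k (θ ⁻¹' {c m}) x) :=
  ENNReal.measurable_ofReal.comp (Finset.measurable_prod _ fun _ _ => h.measurable _)

/-- Distributivity of the product over sums. Total mass, coarsening and one-coordinate marginals are
all sums over such boxes. -/
lemma sum_sampleMeasure_apply [Fintype κ] [DecidableEq κ] [MeasurableSpace κ]
    [MeasurableSingletonClass κ] (h : IsMarkovFamily G μ ν k) {θ : Y → κ}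
    (hθ : Measurable θ) {N : ℕ} (t : Fin N → Finset κ) {A : Set X} (hA : MeasurableSet A) :
    ∑ c ∈ Fintype.piFinset t, sampleMeasure μ k θ c A =
      ∫⁻ x in A, ENNReal.ofReal (∏ m, k (θ ⁻¹' (t m)) x) ∂μ := by
  simp only [sampleMeasure, withDensity_apply _ hA]
  rw [← lintegral_finsetSum _ fun c _ => h.measurable_weight θ c]
  refine lintegral_congr_ae (ae_restrict_of_ae ?_)
  filter_upwards [h.weights hθ, ae_all_iff.2 fun m => h.sum_preimage hθ (t m)] with x h1 h2
  rw [← ENNReal.ofReal_sum_of_nonneg fun c _ => Finset.prod_nonneg fun _ _ => h1.1 _]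
  simp only [← h2]
  rw [Finset.prod_univ_sum]

lemma sum_sampleMeasure [Fintype κ] [MeasurableSpace κ] [MeasurableSingletonClass κ]
    (h : IsMarkovFamily G μ ν k) {θ : Y → κ} (hθ : Measurable θ) (N : ℕ) :
    ∑ c : Fin N → κ, sampleMeasure μ k θ c = μ := by
  classical
  ext A hA
  rw [Measure.finsetSum_apply, ← Fintype.piFinset_univ, h.sum_sampleMeasure_apply hθ _ hA,
    ← setLIntegral_one]
  refine lintegral_congr_ae (ae_restrict_of_ae ?_)
  filter_upwards [h.univ] with x hx
  simp [hx]

lemma sum_sampleMeasure_comp [Fintype κ] [MeasurableSpace κ] [MeasurableSingletonClass κ]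
    [DecidableEq κ'] (h : IsMarkovFamily G μ ν k) {θ : Y → κ} (hθ : Measurable θ)
    (φ : κ → κ') {N : ℕ} (c' : Fin N → κ') :
    ∑ c : Fin N → κ with φ ∘ c = c', sampleMeasure μ k θ c = sampleMeasure μ k (φ ∘ θ) c' := by
  classical
  ext A hA
  have : ({c | φ ∘ c = c'} : Finset (Fin N → κ)) =
      Fintype.piFinset fun m => ({a | φ a = c' m} : Finset κ) := by
    ext c; simp [funext_iff]
  rw [Measure.finsetSum_apply, this, h.sum_sampleMeasure_apply hθ _ hA, sampleMeasure,
    withDensity_apply _ hA]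
  congr 2 with x
  congr 2 with m
  congr 1
  ext; simp

lemma sampleMeasure_map_smul [MeasurableConstSMul G X] [SMulInvariantMeasure G X μ]
    [MeasurableSpace κ] [MeasurableSingletonClass κ] (h : IsMarkovFamily G μ ν k) {θ : Y → κ}
    (hθ : Measurable θ) (g : G) {N : ℕ} (c : Fin N → κ) :
    (sampleMeasure μ k (fun y => θ (g • y)) c).map (g • ·) = sampleMeasure μ k θ c := by
  ext A hA
  have hg : Measurable fun x : X => g • x := measurable_const_smul g
  rw [Measure.map_apply hg hA, sampleMeasure, withDensity_apply _ (hg hA), sampleMeasure,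
    withDensity_apply _ hA, ← (measurePreserving_smul g μ).setLIntegral_comp_preimage hA
      (h.measurable_weight θ c)]
  refine lintegral_congr_ae (ae_restrict_of_ae ?_)
  filter_upwards [ae_all_iff.2 fun m => h.smul g (θ ⁻¹' {c m}) (hθ (measurableSet_singleton _))]
    with x hx
  simp only [← hx]
  rfl

/-- Samples of a join, read at one group element and moved by it, become samples of the original
partition. Hence the conditional entropies along a join do not depend on the group element. -/
lemma labelled_map_smul_comp [MeasurableConstSMul G X] [SMulInvariantMeasure G X μ]
    [Fintype κ] [MeasurableSpace κ] [MeasurableSingletonClass κ]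
    [Fintype κ'] [MeasurableSpace κ'] [MeasurableSingletonClass κ']
    (h : IsMarkovFamily G μ ν k) {θ : Y → κ} (hθ : Measurable θ) (g : G) (φ : κ → κ')
    {η : Y → κ'} (hη : Measurable η) (hφ : ∀ y, φ (θ y) = η (g • y)) (N : ℕ) :
    (labelled fun c : Fin N → κ => sampleMeasure μ k θ c).map (Prod.map (g • ·) (φ ∘ ·)) =
      labelled fun c : Fin N → κ' => sampleMeasure μ k η c := by
  classical
  rw [labelled_map _ (measurable_const_smul g)]
  congr 1 with c' : 1
  rw [← h.sampleMeasure_map_smul hη g c', show (fun y => η (g • y)) = φ ∘ θ from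
    funext fun y => (hφ y).symm, ← h.sum_sampleMeasure_comp hθ φ c']
  have hg : Measurable fun x : X => g • x := measurable_const_smul g
  rw [← Measure.mapₗ_apply_of_measurable hg, map_sum]
  simp only [Measure.mapₗ_apply_of_measurable hg]

/-- A single sample, averaged over `x`, has the law of `θ` under `ν`, since `k B` integrates to `ν
B`. -/
lemma labelled_entropy_coord [Fintype κ] [MeasurableSpace κ] [MeasurableSingletonClass κ]
    (h : IsMarkovFamily G μ ν k) [IsProbabilityMeasure μ] [IsProbabilityMeasure ν]
    {θ : Y → κ} (hθ : Measurable θ) {N : ℕ} (m : Fin N) :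
    entropy (labelled fun c : Fin N → κ => sampleMeasure μ k θ c) (fun ω => ω.2 m) =
      entropy ν θ := by
  classical
  simp only [entropy_eq_sum_negMulLog]
  refine Finset.sum_congr rfl fun b _ => ?_
  congr 1
  have hm : Measurable fun ω : X × (Fin N → κ) => ω.2 m := by fun_prop
  set t : Fin N → Finset κ := fun m' => if m' = m then {b} else Finset.univ with ht
  have hs := h.sum_sampleMeasure_apply hθ t .univ
  rw [← h.integral _ (hθ (measurableSet_singleton b)), measureReal_def,
    labelled_apply _ (hm (measurableSet_singleton b))]
  have h1 : ∑ c : Fin N → κ, sampleMeasure μ k θ c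
      {x | (x, c) ∈ (fun ω : X × (Fin N → κ) => ω.2 m) ⁻¹' {b}} =
      ∑ c ∈ Fintype.piFinset t, sampleMeasure μ k θ c Set.univ := by
    have : Fintype.piFinset t = ({c | c m = b} : Finset (Fin N → κ)) := by
      ext c
      simp only [Fintype.mem_piFinset, Finset.mem_filter, Finset.mem_univ, true_and]
      refine ⟨fun hc => by simpa [ht] using hc m, fun hc m' => ?_⟩
      rcases eq_or_ne m' m with rfl | hne
      · simpa [ht] using hc
      · simp [ht, hne]
    rw [this, Finset.sum_filter]
    refine Finset.sum_congr rfl fun c _ => ?_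
    by_cases hc : c m = b <;> simp [hc]
  rw [h1, hs, Measure.restrict_univ, integral_eq_lintegral_of_nonneg_ae
    (h.nonneg _ (hθ (measurableSet_singleton b))) (h.measurable _).aestronglyMeasurable]
  congr 1
  refine lintegral_congr_ae ?_
  filter_upwards [h.univ] with x hx
  rw [Finset.prod_eq_single m]
  · simp [ht]
  · intro m' _ hne
    simp [ht, hne, hx]
  · simp

/-- The entropy of a join on `X` is controlled by the entropy of a join on `Y` and the conditional
entropy of one partition with respect to independent samples of the other. -/
lemma entropy_joinTranslates_le [MeasurableConstSMul G X] [SMulInvariantMeasure G X μ]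
    [MeasurableConstSMul G Y] [Fintype κ] [MeasurableSpace κ] [MeasurableSingletonClass κ]
    [Fintype κ'] [MeasurableSpace κ'] [MeasurableSingletonClass κ']
    (h : IsMarkovFamily G μ ν k) [IsProbabilityMeasure μ] [IsProbabilityMeasure ν]
    (F : Finset G) [DecidableEq F] {ξ : X → κ'} (hξ : Measurable ξ) {η : Y → κ}
    (hη : Measurable η) (N : ℕ) :
    entropy μ (joinTranslates F ξ) ≤ N * entropy ν (joinTranslates F η) + F.card *
      (entropy (labelled fun c : Fin N → κ => sampleMeasure μ k η c) (fun ω => (ω.2, ξ ω.1)) -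
        entropy (labelled fun c : Fin N → κ => sampleMeasure μ k η c) Prod.snd) := by
  have hθ : Measurable (joinTranslates F η) :=
    measurable_pi_lambda _ fun p => hη.comp (measurable_const_smul _)
  have hsum := h.sum_sampleMeasure hθ N
  -- Each sample is a label of the whole join, so one sample serves all `p ∈ F` at once; this is why
  -- only `N` copies of the entropy on `Y` appear.
  set ρ := labelled fun c : Fin N → (F → κ) => sampleMeasure μ k (joinTranslates F η) c with hρ
  have : IsProbabilityMeasure ρ := isProbabilityMeasure_labelled hsum
  have hsm : ∀ p : F, Measurable fun x : X => (p : G)⁻¹ • x := fun p => measurable_const_smul _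
  have hI : ∀ p : F, Measurable fun ω : X × (Fin N → (F → κ)) => ξ ((p : G)⁻¹ • ω.1) :=
    fun p => hξ.comp ((hsm p).comp measurable_fst)
  have key := entropy_pi_le (ρ := ρ) hI (Z := fun (m : Fin N) (p : F) ω => ω.2 m p)
    (by fun_prop)
  have e1 : entropy ρ (fun ω (p : F) => ξ ((p : G)⁻¹ • ω.1)) = entropy μ (joinTranslates F ξ) := by
    rw [← hsum, ← labelled_map_fst, entropy_map measurable_fst]
    · rfl
    · exact measurable_pi_lambda _ fun p => hξ.comp (hsm p)
  have e2 : ∀ m, entropy ρ (fun ω p => ω.2 m p) = entropy ν (joinTranslates F η) := fun m =>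
    h.labelled_entropy_coord hθ m
  have hmap : ∀ p : F, ρ.map (Prod.map ((p : G)⁻¹ • ·) ((fun f : F → κ => f p) ∘ ·)) =
      labelled fun c : Fin N → κ => sampleMeasure μ k η c := fun p =>
    h.labelled_map_smul_comp hθ (p : G)⁻¹ (fun f : F → κ => f p) hη (fun y => rfl) N
  have hmm : ∀ p : F, Measurable (Prod.map ((p : G)⁻¹ • · : X → X)
      ((fun f : F → κ => f p) ∘ · : (Fin N → F → κ) → (Fin N → κ))) := fun p =>
    (hsm p).prodMap (measurable_of_finite _)
  have e3 : ∀ p : F, entropy ρ (fun ω => (fun m => ω.2 m p, ξ ((p : G)⁻¹ • ω.1))) =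
      entropy (labelled fun c : Fin N → κ => sampleMeasure μ k η c)
        (fun ω => (ω.2, ξ ω.1)) := fun p => by
    rw [← hmap p, entropy_map (hmm p) (by fun_prop)]
    rfl
  have e4 : ∀ p : F, entropy ρ (fun ω m => ω.2 m p) =
      entropy (labelled fun c : Fin N → κ => sampleMeasure μ k η c) Prod.snd := fun p => by
    rw [← hmap p, entropy_map (hmm p) measurable_snd]
    rfl
  simp only [e1, e2, e3, e4, Finset.sum_const, Finset.card_univ, Fintype.card_fin,
    Fintype.card_coe, nsmul_eq_mul] at key
  exact key

end IsMarkovFamily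

end Sampling

end PEntropy

/-! ### The law of large numbers and the factor generated by `k B` -/

namespace PEntropy

open scoped ENNReal Topology

/-- The variance of a count of `N` independent trials: after centring, off-diagonal covariances
contain a factor of mean zero, and each diagonal term is at most `1`. -/
lemma sum_prod_mul_sq_sub_le {κ : Type*} [Fintype κ] [DecidableEq κ] {w : κ → ℝ}
    (hw : ∀ c, 0 ≤ w c) (hw1 : ∑ c, w c = 1) (t : Finset κ) (N : ℕ) :
    ∑ c : Fin N → κ, (∏ m, w (c m)) *
      (∑ m, (if c m ∈ t then (1 : ℝ) else 0) - N * ∑ c ∈ t, w c) ^ 2 ≤ N := by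
  set u := ∑ c ∈ t, w c with hu
  have hu0 : 0 ≤ u := Finset.sum_nonneg fun c _ => hw c
  have hu1 : u ≤ 1 := hw1 ▸ Finset.sum_le_univ_sum_of_nonneg hw
  set v : κ → ℝ := fun c => (if c ∈ t then (1 : ℝ) else 0) - u with hv
  have hv0 : ∑ c, w c * v c = 0 := by
    simp only [hv, mul_sub, Finset.sum_sub_distrib, ← Finset.sum_mul, hw1]
    simp [hu]
  have hv2 : ∑ c, w c * (v c * v c) ≤ 1 := by
    rw [← hw1]
    refine Finset.sum_le_sum fun c _ => mul_le_of_le_one_right (hw c) ?_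
    simp only [hv]
    split_ifs <;> nlinarith
  have hcov : ∀ a b : Fin N, ∑ c : Fin N → κ, (∏ m, w (c m)) * (v (c a) * v (c b)) =
      if a = b then ∑ c, w c * (v c * v c) else 0 := by
    intro a b
    have h1 : ∀ c : Fin N → κ, (∏ m, w (c m)) * (v (c a) * v (c b)) =
        ∏ m, w (c m) * ((if m = a then v (c m) else 1) * (if m = b then v (c m) else 1)) := by
      intro c
      rw [Finset.prod_mul_distrib, Finset.prod_mul_distrib]
      simp
    simp only [h1]
    rw [← Fintype.piFinset_univ, ← Finset.prod_univ_sum (fun _ => Finset.univ)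
      (fun m c => w c * ((if m = a then v c else 1) * (if m = b then v c else 1)))]
    split_ifs with hab
    · subst hab
      rw [Finset.prod_eq_single a (fun m _ hm => by simp [hm, hw1]) (by simp)]
      simp
    · refine Finset.prod_eq_zero (Finset.mem_univ a) ?_
      simpa [hab] using hv0
  have hexp : ∀ c : Fin N → κ,
      (∏ m, w (c m)) * (∑ m, (if c m ∈ t then (1 : ℝ) else 0) - N * u) ^ 2 =
      ∑ a, ∑ b, (∏ m, w (c m)) * (v (c a) * v (c b)) := by
    intro c
    simp only [← Finset.mul_sum, ← Finset.sum_mul]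
    rw [← sq]
    simp [hv]
  simp only [hexp]
  rw [Finset.sum_comm]
  calc ∑ a : Fin N, ∑ c : Fin N → κ, ∑ b, (∏ m, w (c m)) * (v (c a) * v (c b))
      = ∑ a : Fin N, ∑ c, w c * (v c * v c) := by
        refine Finset.sum_congr rfl fun a _ => ?_
        rw [Finset.sum_comm]
        simp [hcov]
    _ ≤ ∑ a : Fin N, (1 : ℝ) := Finset.sum_le_sum fun _ _ => hv2
    _ = N := by simp

lemma comap_le_of_measurableSet_lt {X : Type*} {m : MeasurableSpace X} {f : X → ℝ}
    (h : ∀ a, MeasurableSet[m] {x | f x < a}) : MeasurableSpace.comap f inferInstance ≤ m :=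
  (measurable_of_Iio h).comap_le

/-- The factor generated by the translates of a function. -/
@[reducible]
def orbitAlgebra (G : Type*) {X : Type*} [Group G] [MulAction G X] (f : X → ℝ) :
    MeasurableSpace X :=
  ⨆ γ : G, MeasurableSpace.comap (fun x => f (γ • x)) inferInstance

lemma comap_le_orbitAlgebra (G : Type*) {X : Type*} [Group G] [MulAction G X] (f : X → ℝ) (γ : G) :
    MeasurableSpace.comap (fun x => f (γ • x)) inferInstance ≤ orbitAlgebra G f :=
  le_iSup (fun γ : G => MeasurableSpace.comap (fun x => f (γ • x)) inferInstance) γ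

lemma isFactor_orbitAlgebra (G : Type*) {X : Type*} [Group G] [MulAction G X] [MeasurableSpace X]
    [MeasurableConstSMul G X] {f : X → ℝ} (hf : Measurable f) : IsFactor G (orbitAlgebra G f) := by
  refine ⟨iSup_le fun γ => (hf.comp (measurable_const_smul γ)).comap_le, fun γ A hA => ?_⟩
  have : Measurable[orbitAlgebra G f, orbitAlgebra G f] fun x : X => γ • x := by
    refine measurable_iff_comap_le.2 ?_
    rw [MeasurableSpace.comap_iSup]
    refine iSup_le fun γ' => ?_
    rw [MeasurableSpace.comap_comp]
    refine le_trans (le_of_eq ?_) (comap_le_orbitAlgebra G f (γ' * γ))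
    congr 1
    ext x
    simp [mul_smul]
  exact this hA

section Prediction

variable {G X Y κ : Type*} [Group G]
  [MulAction G X] [MeasurableSpace X] [MulAction G Y] [MeasurableSpace Y]
  {μ : Measure X} {ν : Measure Y} {k : Set Y → X → ℝ}

namespace IsMarkovFamily

/-- Chebyshev's inequality over each `x`, integrated against `μ`. -/
lemma sum_sampleMeasure_deviation_le [IsProbabilityMeasure μ] [Fintype κ] [DecidableEq κ]
    [MeasurableSpace κ] [MeasurableSingletonClass κ] (h : IsMarkovFamily G μ ν k) {θ : Y → κ}
    (hθ : Measurable θ) {N : ℕ} (hN : 0 < N) (t : Finset κ) {δ : ℝ} (hδ : 0 < δ) :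
    ∑ c : Fin N → κ, sampleMeasure μ k θ c {x | δ ≤
      |(∑ m, if c m ∈ t then (1 : ℝ) else 0) / N - k (θ ⁻¹' t) x|} ≤
      ENNReal.ofReal (1 / (N * δ ^ 2)) := by
  have hN' : (0 : ℝ) < N := by exact_mod_cast hN
  set e : (Fin N → κ) → ℝ := fun c => ∑ m, if c m ∈ t then (1 : ℝ) else 0 with he
  have hmeas : ∀ c, MeasurableSet {x | δ ≤ |e c / N - k (θ ⁻¹' t) x|} := fun c =>
    measurableSet_le measurable_const ((measurable_const.sub (h.measurable _)).abs)
  have h1 : ∀ c : Fin N → κ, sampleMeasure μ k θ c {x | δ ≤ |e c / N - k (θ ⁻¹' t) x|} ≤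
      ∫⁻ x, ENNReal.ofReal (∏ m, k (θ ⁻¹' {c m}) x) *
        ENNReal.ofReal ((e c - N * k (θ ⁻¹' t) x) ^ 2 / (N * δ) ^ 2) ∂μ := by
    intro c
    rw [sampleMeasure, withDensity_apply _ (hmeas c), ← lintegral_indicator (hmeas c)]
    refine lintegral_mono fun x => ?_
    by_cases hx : x ∈ {x | δ ≤ |e c / N - k (θ ⁻¹' t) x|}
    · rw [Set.indicator_of_mem hx]
      refine le_mul_of_one_le_right zero_le ?_
      rw [ENNReal.one_le_ofReal, one_le_div (by positivity), ← sq_abs (e c - _)]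
      refine pow_le_pow_left₀ (by positivity) ?_ 2
      have : e c - N * k (θ ⁻¹' t) x = N * (e c / N - k (θ ⁻¹' t) x) := by field_simp
      rw [this, abs_mul, abs_of_pos hN']
      exact mul_le_mul_of_nonneg_left hx hN'.le
    · rw [Set.indicator_of_notMem hx]
      exact zero_le
  refine (Finset.sum_le_sum fun c _ => h1 c).trans ?_
  have hsq : ∀ c, Measurable fun x =>
      ENNReal.ofReal ((e c - N * k (θ ⁻¹' t) x) ^ 2 / (N * δ) ^ 2) := fun c =>
    ENNReal.measurable_ofReal.comp
      (((measurable_const.sub ((h.measurable _).const_mul _)).pow_const 2).div_const _)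
  have hprod : ∀ c, Measurable fun x => ENNReal.ofReal (∏ m, k (θ ⁻¹' {c m}) x) *
      ENNReal.ofReal ((e c - N * k (θ ⁻¹' t) x) ^ 2 / (N * δ) ^ 2) := fun c =>
    (h.measurable_weight θ c).mul (hsq c)
  rw [← lintegral_finsetSum _ fun c _ => hprod c]
  calc ∫⁻ x, ∑ c : Fin N → κ, ENNReal.ofReal (∏ m, k (θ ⁻¹' {c m}) x) *
        ENNReal.ofReal ((e c - N * k (θ ⁻¹' t) x) ^ 2 / (N * δ) ^ 2) ∂μ
      ≤ ∫⁻ _, ENNReal.ofReal (1 / (N * δ ^ 2)) ∂μ := by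
        refine lintegral_mono_ae ?_
        filter_upwards [h.weights hθ, h.sum_preimage hθ t] with x hx ht
        simp only [← ENNReal.ofReal_mul (Finset.prod_nonneg fun m _ => hx.1 _)]
        rw [← ENNReal.ofReal_sum_of_nonneg fun c _ =>
          mul_nonneg (Finset.prod_nonneg fun m _ => hx.1 _) (by positivity)]
        refine ENNReal.ofReal_le_ofReal ?_
        have := sum_prod_mul_sq_sub_le hx.1 hx.2 t N
        rw [ht] at this
        simp only [← mul_div_assoc]
        rw [← Finset.sum_div, div_le_div_iff₀ (by positivity) (by positivity)]
        have h3 := mul_le_mul_of_nonneg_right this (by positivity : 0 ≤ (N : ℝ) * δ ^ 2)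
        linarith
    _ = ENNReal.ofReal (1 / (N * δ ^ 2)) := by simp

lemma predictionError_lt_le [IsProbabilityMeasure μ] [Fintype κ] [DecidableEq κ]
    [MeasurableSpace κ] [MeasurableSingletonClass κ] (h : IsMarkovFamily G μ ν k) {θ : Y → κ}
    (hθ : Measurable θ) {N : ℕ} (hN : 0 < N) (t : Finset κ) {δ : ℝ} (hδ : 0 < δ) (a : ℝ) :
    predictionError (fun c : Fin N → κ => sampleMeasure μ k θ c) {x | k (θ ⁻¹' t) x < a} ≤
      μ {x | a - 2 * δ ≤ k (θ ⁻¹' t) x ∧ k (θ ⁻¹' t) x < a} +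
        ENNReal.ofReal (1 / (N * δ ^ 2)) := by
  refine le_trans ?_ (add_le_add_right (h.sum_sampleMeasure_deviation_le hθ hN t hδ) _)
  rw [show μ {x | a - 2 * δ ≤ k (θ ⁻¹' t) x ∧ k (θ ⁻¹' t) x < a} = ∑ c : Fin N → κ,
      sampleMeasure μ k θ c {x | a - 2 * δ ≤ k (θ ⁻¹' t) x ∧ k (θ ⁻¹' t) x < a} by
    rw [← Measure.finsetSum_apply, h.sum_sampleMeasure hθ N], predictionError, ← Finset.sum_add_distrib]
  refine Finset.sum_le_sum fun c _ => ?_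
  -- Predict from the empirical frequency with threshold `a - δ`, the midpoint of the window `[a -
  -- 2δ, a)`. Outside the window, a wrong guess forces a deviation of at least `δ`.
  set e : ℝ := (∑ m, if c m ∈ t then (1 : ℝ) else 0) / N
  rcases lt_or_ge e (a - δ) with he | he
  · refine (min_le_right _ _).trans (le_trans (measure_mono fun x hx => ?_) le_add_self)
    simp only [Set.mem_compl_iff, Set.mem_ofPred_eq, not_lt] at hx ⊢
    rw [abs_sub_comm]
    exact le_trans (by linarith) (le_abs_self _)
  · refine (min_le_left _ _).trans (le_trans (measure_mono fun x hx => ?_) (measure_union_le _ _))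
    simp only [Set.mem_union, Set.mem_ofPred_eq] at hx ⊢
    rcases lt_or_ge (k (θ ⁻¹' t) x) (a - 2 * δ) with hk | hk
    · exact Or.inr (le_trans (by linarith) (le_abs_self _))
    · exact Or.inl ⟨hk, hx⟩

/-- A partition of `X` that is asymptotically predictable from samples of partitions of `Y` has
zero entropy if `ν` has zero entropy. -/
lemma partitionPEntropy_nonpos [MeasurableConstSMul G X] [SMulInvariantMeasure G X μ]
    [MeasurableConstSMul G Y] [IsProbabilityMeasure μ] [IsProbabilityMeasure ν]
    (h : IsMarkovFamily G μ ν k) {P : ℕ → Finset G} (hP : ∀ j, (P j).Nonempty)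
    (hS : pEntropy ν P = 0) {l : ℕ → ℕ} {η : ∀ n, Y → Fin (l n)} (hη : ∀ n, Measurable (η n))
    {r : ℕ} {ξ : X → Fin r} (hξ : Measurable ξ)
    (herr : ∀ i, Tendsto (fun n => predictionError
      (fun c : Fin n → Fin (l n) => sampleMeasure μ k (η n) c) (ξ ⁻¹' {i})) atTop (𝓝 0)) :
    partitionPEntropy μ P ξ ≤ 0 := by
  classical
  have hη0 : ∀ n, partitionPEntropy ν P (η n) ≤ 0 := fun n => by
    rw [← hS, pEntropy, factorPEntropy]
    exact le_iSup₂_of_le (l n) (η n) (le_iSup_of_le (hη n) le_rfl)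
  have hreal : ∀ δ : ℝ, 0 < δ → partitionPEntropy μ P ξ ≤ (δ : EReal) := by
    intro δ hδ
    -- The budget `δ` is split in three: `r * ε`, the prediction errors, and `n` times the mean
    -- entropy on `Y`. The sample size `n` is fixed before `j` grows.
    set ε : ℝ := δ / (3 * (r + 1)) with hε
    have hε0 : 0 < ε := by positivity
    have hrε : r * ε ≤ δ / 3 := by
      rw [hε, mul_div_assoc', div_le_div_iff₀ (by positivity) (by positivity)]
      nlinarith
    have hlim : Tendsto (fun n => max 1 (-Real.log ε) * ∑ i, (predictionError
        (fun c : Fin n → Fin (l n) => sampleMeasure μ k (η n) c) (ξ ⁻¹' {i})).toReal)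
        atTop (𝓝 0) := by
      have := (tendsto_finsetSum Finset.univ fun i _ =>
        (ENNReal.tendsto_toReal ENNReal.zero_ne_top).comp (herr i)).const_mul
          (max 1 (-Real.log ε))
      simpa using this
    obtain ⟨n, hn⟩ := (hlim.eventually_lt_const (by positivity : (0 : ℝ) < δ / 3)).exists
    have hcond := labelled_entropy_sub_le (h.sum_sampleMeasure (hη n) n) hξ hε0
    have hnδ : n * (δ / (3 * (n + 1))) ≤ δ / 3 := by
      rw [mul_div_assoc', div_le_div_iff₀ (by positivity) (by positivity)]
      nlinarith
    have hν : ∀ᶠ j in atTop, ((meanEntropy ν (P j) (η n) : ℝ) : EReal) <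
        ((δ / (3 * (n + 1)) : ℝ) : EReal) :=
      eventually_lt_of_limsup_lt ((hη0 n).trans_lt (by exact_mod_cast (by positivity)))
    refine limsup_le_of_le (by isBoundedDefault) ?_
    filter_upwards [hν] with j hj
    have hj' : meanEntropy ν (P j) (η n) < δ / (3 * (n + 1)) := by exact_mod_cast hj
    have hcard : (0 : ℝ) < (P j).card := by exact_mod_cast (hP j).card_pos
    have hmain := h.entropy_joinTranslates_le (P j) hξ (hη n) n
    have hmean : meanEntropy μ (P j) ξ ≤ n * meanEntropy ν (P j) (η n) +
        (entropy (labelled fun c : Fin n → Fin (l n) => sampleMeasure μ k (η n) c)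
          (fun ω => (ω.2, ξ ω.1)) -
        entropy (labelled fun c : Fin n → Fin (l n) => sampleMeasure μ k (η n) c) Prod.snd) := by
      have hmul := mul_le_mul_of_nonneg_left hmain (one_div_nonneg.2 hcard.le)
      rw [meanEntropy, meanEntropy]
      refine le_trans (le_of_eq ?_) (hmul.trans (le_of_eq ?_))
      · congr!
      · field_simp
    have hfin : meanEntropy μ (P j) ξ ≤ δ := by
      have := mul_le_mul_of_nonneg_left hj'.le (Nat.cast_nonneg (α := ℝ) n)
      linarith
    exact_mod_cast hfin
  refine le_of_forall_gt_imp_ge_of_dense fun b hb => ?_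
  obtain ⟨δ, hδ0, hδb⟩ := EReal.lt_iff_exists_real_btwn.1 hb
  exact (hreal δ (by exact_mod_cast hδ0)).trans hδb.le

/-- The translates of the level sets of `k B` are asymptotically predictable from samples of
translates of `B`. -/
lemma tendsto_predictionError_lt [IsProbabilityMeasure μ] [MeasurableConstSMul G Y]
    (h : IsMarkovFamily G μ ν k) {B : Set Y} (hB : MeasurableSet B) (g : G) (a : ℝ)
    {l : ℕ → ℕ} {η : ∀ n, Y → Fin (l n)} (hη : ∀ n, Measurable (η n))
    (hpre : ∀ᶠ n in atTop, ∃ t : Finset (Fin (l n)), (η n) ⁻¹' t = (g • ·) ⁻¹' B) :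
    Tendsto (fun n => predictionError (fun c : Fin n → Fin (l n) => sampleMeasure μ k (η n) c)
      {x | k B (g • x) < a}) atTop (𝓝 0) := by
  set u := k ((g • ·) ⁻¹' B) with hu
  have hum : Measurable u := h.measurable _
  have hset : {x | k B (g • x) < a} =ᵐ[μ] {x | u x < a} := by
    filter_upwards [h.smul g B hB] with x hx
    exact propext (by simp only [hu, ← hx] : k B (g • x) < a ↔ u x < a)
  -- The windows exclude `a`, so they decrease to the empty set even when `{u = a}` has positive
  -- measure.
  have hgap : Tendsto (fun i : ℕ => μ {x | a - 2 * (1 / ((i : ℝ) + 1)) ≤ u x ∧ u x < a}) atTop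
      (𝓝 0) := by
    have := tendsto_measure_iInter_atTop (μ := μ)
      (s := fun i : ℕ => {x | a - 2 * (1 / ((i : ℝ) + 1)) ≤ u x ∧ u x < a})
      (fun i => ((measurableSet_le measurable_const hum).inter
        (measurableSet_lt hum measurable_const)).nullMeasurableSet)
      (fun i j hij x hx => ⟨le_trans (by
        have : 1 / ((j : ℝ) + 1) ≤ 1 / ((i : ℝ) + 1) := Nat.one_div_le_one_div hij
        linarith) hx.1, hx.2⟩) ⟨0, measure_ne_top _ _⟩
    have hemp : ⋂ i : ℕ, {x | a - 2 * (1 / ((i : ℝ) + 1)) ≤ u x ∧ u x < a} = ∅ := by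
      refine Set.eq_empty_of_forall_notMem fun x hx => ?_
      rw [Set.mem_iInter] at hx
      obtain ⟨i, hi⟩ := exists_nat_one_div_lt (half_pos (sub_pos.2 (hx 0).2))
      have := (hx i).1
      linarith
    rwa [hemp, measure_empty] at this
  rw [ENNReal.tendsto_nhds_zero]
  intro ε hε
  obtain ⟨i, hi⟩ := ((ENNReal.tendsto_nhds_zero.1 hgap) (ε / 2) (ENNReal.half_pos hε.ne')).exists
  have hδ : (0 : ℝ) < 1 / ((i : ℝ) + 1) := Nat.one_div_pos_of_nat
  have hN : Tendsto (fun n : ℕ => ENNReal.ofReal (1 / (n * (1 / ((i : ℝ) + 1)) ^ 2))) atTop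
      (𝓝 0) := by
    rw [← ENNReal.ofReal_zero]
    refine ENNReal.tendsto_ofReal (tendsto_const_nhds.div_atTop ?_)
    exact tendsto_natCast_atTop_atTop.atTop_mul_const (by positivity)
  filter_upwards [(ENNReal.tendsto_nhds_zero.1 hN) (ε / 2) (ENNReal.half_pos hε.ne'), hpre,
    eventually_gt_atTop 0] with n hn ⟨t, ht⟩ hn0
  rw [predictionError_congr (h.sum_sampleMeasure (hη n) n) hset]
  have := h.predictionError_lt_le (hη n) hn0 t hδ a
  rw [ht] at this
  exact this.trans ((add_le_add hi hn).trans (ENNReal.add_halves ε).le)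

/-- If the action on `X` has completely positive entropy and the action on `Y` zero entropy, then
every equivariant Markov operator maps indicators to constants. -/
theorem ae_eq_const [Countable G] [MeasurableConstSMul G X] [SMulInvariantMeasure G X μ]
    [MeasurableConstSMul G Y] [IsProbabilityMeasure μ] [IsProbabilityMeasure ν]
    (h : IsMarkovFamily G μ ν k) {P : ℕ → Finset G} (hP : ∀ j, (P j).Nonempty)
    (hT : HasCompletelyPositivePEntropy μ P) (hS : pEntropy ν P = 0)
    {B : Set Y} (hB : MeasurableSet B) : ∀ᵐ x ∂μ, k B x = ν.real B := by
  classical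
  obtain ⟨g, hg⟩ := exists_surjective_nat G
  let e : ∀ n : ℕ, (Fin n → Bool) ≃ Fin (Fintype.card (Fin n → Bool)) := fun n =>
    Fintype.equivFin _
  -- The partition by the first `n` translates of `B` in an enumeration of `G`; eventually it
  -- resolves any given translate. The index `n` also serves as the sample size.
  let η : ∀ n : ℕ, Y → Fin (Fintype.card (Fin n → Bool)) := fun n y =>
    e n fun i => decide (g i • y ∈ B)
  have hη : ∀ n, Measurable (η n) := fun n =>
    (measurable_of_finite (e n)).comp (measurable_pi_lambda _ fun i =>
      measurable_to_bool (by
        convert measurable_const_smul (g i) hB using 1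
        ext y; simp))
  have hpre : ∀ γ : G, ∀ᶠ n in atTop, ∃ t : Finset (Fin (Fintype.card (Fin n → Bool))),
      (η n) ⁻¹' t = (γ • ·) ⁻¹' B := by
    intro γ
    obtain ⟨i, rfl⟩ := hg γ
    filter_upwards [eventually_gt_atTop i] with n hn
    refine ⟨Finset.univ.filter fun c => (e n).symm c ⟨i, hn⟩ = true, ?_⟩
    ext y; simp [η]
  -- Predictable sets form a σ-algebra, so only the generating level sets need checking.
  have hFL : orbitAlgebra G (k B) ≤ asymptoticAlgebra μ
      (fun n (c : Fin n → Fin (Fintype.card (Fin n → Bool))) => sampleMeasure μ k (η n) c)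
      fun n => h.sum_sampleMeasure (hη n) n :=
    iSup_le fun γ => comap_le_of_measurableSet_lt fun a =>
      ⟨((h.measurable B).comp (measurable_const_smul γ)) measurableSet_Iio,
        h.tendsto_predictionError_lt hB γ a hη (hpre γ)⟩
  have hF0 : factorPEntropy (orbitAlgebra G (k B)) μ P ≤ 0 := by
    refine iSup_le fun r => iSup_le fun ξ => iSup_le fun hξ => ?_
    exact h.partitionPEntropy_nonpos hP hS hη (fun A hA => (hFL _ (hξ hA)).1)
      fun i => (hFL _ (hξ (measurableSet_singleton i))).2
  have htriv : ¬ IsNontrivialAlgebra (orbitAlgebra G (k B)) μ := fun hn =>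
    (hT _ (isFactor_orbitAlgebra G (h.measurable B)) hn).not_ge hF0
  -- All level sets of `k B` have measure `0` or `1`, which makes a real function a.e. constant.
  have hconst : ∃ a, k B =ᵐ[μ] fun _ => a := by
    refine exists_eventuallyEq_const_of_forall_separating (MeasurableSet) fun U hU => ?_
    have hU' : MeasurableSet[orbitAlgebra G (k B)] (k B ⁻¹' U) :=
      comap_le_orbitAlgebra G (k B) 1 _ ⟨U, hU, by simp⟩
    by_contra! hcon
    refine htriv ⟨_, hU', fun h0 => hcon.2 ?_, fun h1 => hcon.1 ?_⟩
    · exact measure_eq_zero_iff_ae_notMem.1 h0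
    · filter_upwards [(mem_ae_iff_prob_eq_one (h.measurable B hU)).2 h1] with x hx
      exact not_not.2 hx
  obtain ⟨a, ha⟩ := hconst
  filter_upwards [ha] with x hx
  rw [hx, ← h.integral B hB, integral_congr_ae ha]
  simp

end IsMarkovFamily

end Prediction

end PEntropy

/-! ### Markov operators on `L²`, disjointness and independence -/

namespace PEntropy

open scoped ENNReal Topology

open ContinuousLinearMap (adjoint adjoint_inner_left adjoint_inner_right)

section Operators

variable {G X Y Z : Type*} [Group G]
  [MulAction G X] [MeasurableSpace X] [MeasurableConstSMul G X]
  [MulAction G Y] [MeasurableSpace Y] [MeasurableConstSMul G Y]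
  [MulAction G Z] [MeasurableSpace Z] [MeasurableConstSMul G Z]
  {μ : Measure X} [SMulInvariantMeasure G X μ]
  {ν : Measure Y} [SMulInvariantMeasure G Y ν]
  {lam : Measure Z} [SMulInvariantMeasure G Z lam]

lemma inner_nonneg_of_nonneg {f g : Lp ℝ 2 μ} (hf : 0 ≤ f) (hg : 0 ≤ g) : 0 ≤ inner ℝ f g := by
  rw [L2.inner_def]
  refine integral_nonneg_of_ae ?_
  filter_upwards [(Lp.coeFn_nonneg f).2 hf, (Lp.coeFn_nonneg g).2 hg] with x h1 h2
  simpa using mul_nonneg h2 h1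

lemma inner_koopman_koopman (g : G) (f h : Lp ℝ 2 μ) :
    inner ℝ (koopman μ g f) (koopman μ g h) = inner ℝ f h :=
  (Lp.compMeasurePreservingₗᵢ ℝ (g • ·) (measurePreserving_smul g μ)).inner_map_map f h

lemma koopman_koopman_inv (g : G) (f : Lp ℝ 2 μ) : koopman μ g (koopman μ g⁻¹ f) = f := by
  rw [koopman, koopman, ← Lp.compMeasurePreserving_comp_apply]
  refine Lp.ext ?_
  filter_upwards [Lp.coeFn_compMeasurePreserving f ((measurePreserving_smul g⁻¹ μ).comp
    (measurePreserving_smul g μ))] with x hx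
  rw [hx]
  simp

/-- The lift of functions along a factor map, as an operator on `L²`. -/
noncomputable def factorLift (π : Z → X) (hπ : MeasurePreserving π lam μ) :
    Lp ℝ 2 μ →L[ℝ] Lp ℝ 2 lam :=
  (Lp.compMeasurePreservingₗᵢ ℝ π hπ).toContinuousLinearMap

lemma coeFn_factorLift {π : Z → X} (hπ : MeasurePreserving π lam μ) (f : Lp ℝ 2 μ) :
    factorLift π hπ f =ᵐ[lam] f ∘ π :=
  Lp.coeFn_compMeasurePreserving f hπ

variable [IsProbabilityMeasure μ] [IsProbabilityMeasure ν] [IsProbabilityMeasure lam]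

/-- The indicator of a measurable set in `L²`. -/
noncomputable abbrev indicatorL2 (μ : Measure X) [IsProbabilityMeasure μ] {s : Set X}
    (hs : MeasurableSet s) : Lp ℝ 2 μ :=
  indicatorConstLp 2 hs (measure_ne_top μ s) 1

lemma integral_indicatorL2 {s : Set X} (hs : MeasurableSet s) :
    ∫ x, indicatorL2 μ hs x ∂μ = μ.real s := by
  rw [← setIntegral_univ, setIntegral_indicatorConstLp .univ]
  simp

lemma inner_const_left (c : ℝ) (f : Lp ℝ 2 μ) :
    inner ℝ (Lp.const 2 μ c) f = c * ∫ x, f x ∂μ := by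
  rw [← indicatorConstLp_univ, L2.inner_indicatorConstLp_eq_inner_setIntegral, setIntegral_univ]
  simp [mul_comm]

lemma ext_inner_indicatorL2 {f g : Lp ℝ 2 μ}
    (h : ∀ (s : Set X) (hs : MeasurableSet s),
      inner ℝ (indicatorL2 μ hs) f = inner ℝ (indicatorL2 μ hs) g) : f = g := by
  refine Lp.ext (Lp.ae_eq_of_forall_setIntegral_eq f g two_ne_zero ENNReal.ofNat_ne_top
    (fun s _ hs => integrableOn_Lp_of_measure_ne_top f fact_one_le_two_ennreal.elim hs.ne)
    (fun s _ hs => integrableOn_Lp_of_measure_ne_top g fact_one_le_two_ennreal.elim hs.ne)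
    fun s hs _ => ?_)
  have := h s hs
  rwa [L2.inner_indicatorConstLp_one, L2.inner_indicatorConstLp_one] at this

lemma nonneg_of_inner_indicatorL2 {f : Lp ℝ 2 μ}
    (h : ∀ (s : Set X) (hs : MeasurableSet s), 0 ≤ inner ℝ (indicatorL2 μ hs) f) : 0 ≤ f := by
  refine (Lp.coeFn_nonneg f).1 (ae_nonneg_of_forall_setIntegral_nonneg
    ((Lp.memLp f).integrable fact_one_le_two_ennreal.elim) fun s hs _ => ?_)
  have := h s hs
  rwa [L2.inner_indicatorConstLp_one] at this

lemma indicatorL2_nonneg {s : Set X} (hs : MeasurableSet s) : 0 ≤ indicatorL2 μ hs := by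
  refine (Lp.coeFn_nonneg _).1 ?_
  filter_upwards [indicatorConstLp_coeFn (p := 2) (hs := hs) (hμs := measure_ne_top μ s)
    (c := (1 : ℝ))] with x hx
  rw [hx]
  exact Set.indicator_nonneg (fun _ _ => zero_le_one) x

lemma koopman_indicatorL2 (g : G) {s : Set X} (hs : MeasurableSet s) :
    koopman μ g (indicatorL2 μ hs) = indicatorL2 μ (measurable_const_smul g hs) :=
  Lp.indicatorConstLp_compMeasurePreserving hs _ _ _

namespace IsMarkovIntertwining

variable {J : Lp ℝ 2 μ →L[ℝ] Lp ℝ 2 ν}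

/-- Positivity is self-dual when tested against indicators, and equivariance passes to the adjoint
because Koopman operators are unitary. -/
protected lemma adjoint (h : IsMarkovIntertwining G μ ν J) :
    IsMarkovIntertwining G ν μ (adjoint J) where
  nonneg f hf := nonneg_of_inner_indicatorL2 fun s hs => by
    rw [adjoint_inner_right]
    exact inner_nonneg_of_nonneg (h.nonneg _ (indicatorL2_nonneg hs)) hf
  map_one := h.adjoint_one
  adjoint_one := by rw [ContinuousLinearMap.adjoint_adjoint]; exact h.map_one
  intertwines g f := by
    refine ext_inner_left ℝ fun v => ?_
    rw [adjoint_inner_right, ← koopman_koopman_inv g v, h.intertwines, inner_koopman_koopman,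
      inner_koopman_koopman, adjoint_inner_right]

protected lemma comp (h : IsMarkovIntertwining G μ ν J) {K : Lp ℝ 2 ν →L[ℝ] Lp ℝ 2 lam}
    (hK : IsMarkovIntertwining G ν lam K) : IsMarkovIntertwining G μ lam (K ∘L J) where
  nonneg f hf := hK.nonneg _ (h.nonneg f hf)
  map_one := by rw [ContinuousLinearMap.comp_apply, h.map_one, hK.map_one]
  adjoint_one := by
    rw [ContinuousLinearMap.adjoint_comp, ContinuousLinearMap.comp_apply, hK.adjoint_one,
      h.adjoint_one]
  intertwines g f := by
    rw [ContinuousLinearMap.comp_apply, h.intertwines, hK.intertwines,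
      ContinuousLinearMap.comp_apply]

lemma map_indicatorL2_ae (h : IsMarkovIntertwining G μ ν J) (g : G) {s : Set X}
    (hs : MeasurableSet s) :
    ∀ᵐ y ∂ν, J (indicatorL2 μ (measurable_const_smul g hs)) y = J (indicatorL2 μ hs) (g • y) := by
  rw [← koopman_indicatorL2, h.intertwines]
  exact Lp.coeFn_compMeasurePreserving _ _

open Classical in
/-- The images of indicators under a Markov intertwining form a Markov family. -/
lemma isMarkovFamily (h : IsMarkovIntertwining G μ ν J) :
    IsMarkovFamily G ν μ fun s y =>
      if hs : MeasurableSet s then J (indicatorL2 μ hs) y else 0 where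
  measurable B := by
    by_cases hB : MeasurableSet B
    · simpa only [hB, dite_true] using (Lp.stronglyMeasurable _).measurable
    · simpa only [hB, dite_false] using measurable_const
  nonneg B hB := by
    simp only [hB, dite_true]
    exact (Lp.coeFn_nonneg _).2 (h.nonneg _ (indicatorL2_nonneg hB))
  union B C hB hC hBC := by
    simp only [hB, hC, hB.union hC, dite_true]
    rw [indicatorL2, indicatorConstLp_disjoint_union hB hC (measure_ne_top μ B)
      (measure_ne_top μ C) hBC, map_add]
    exact Lp.coeFn_add _ _
  univ := by
    simp only [MeasurableSet.univ, dite_true]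
    rw [indicatorL2, indicatorConstLp_univ, h.map_one]
    exact Lp.coeFn_const ..
  integral B hB := by
    simp only [hB, dite_true]
    have h1 : inner ℝ (Lp.const 2 ν 1) (J (indicatorL2 μ hB)) = μ.real B := by
      rw [← adjoint_inner_left, h.adjoint_one, inner_const_left, one_mul,
        integral_indicatorL2]
    rwa [inner_const_left, one_mul] at h1
  smul g B hB := by
    have hg : MeasurableSet ((g • ·) ⁻¹' B : Set X) := measurable_const_smul g hB
    simp only [hB, hg, dite_true]
    exact h.map_indicatorL2_ae g hB

end IsMarkovIntertwining

lemma isMarkovIntertwining_factorLift {π : Z → X} (hπ : MeasurePreserving π lam μ)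
    (hG : ∀ g : G, ∀ᵐ z ∂lam, π (g • z) = g • π z) :
    IsMarkovIntertwining G μ lam (factorLift π hπ) where
  nonneg f hf := by
    refine (Lp.coeFn_nonneg _).1 ?_
    filter_upwards [coeFn_factorLift hπ f,
      hπ.quasiMeasurePreserving.ae ((Lp.coeFn_nonneg f).2 hf)] with z h1 h2
    rw [h1]
    exact h2
  map_one := by
    refine Lp.ext ?_
    filter_upwards [coeFn_factorLift hπ (Lp.const 2 μ 1), Lp.coeFn_const (p := 2) (μ := lam) (1 : ℝ),
      hπ.quasiMeasurePreserving.ae (Lp.coeFn_const (p := 2) (μ := μ) (1 : ℝ))] with z h1 h2 h3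
    rw [h1, h2, Function.comp_apply, h3]
    rfl
  adjoint_one := by
    refine ext_inner_right ℝ fun f => ?_
    rw [adjoint_inner_left, inner_const_left, inner_const_left,
      integral_congr_ae (coeFn_factorLift hπ f)]
    congr 1
    have := integral_map (f := f) hπ.aemeasurable
      (hπ.map_eq.symm ▸ (Lp.stronglyMeasurable f).aestronglyMeasurable)
    rw [hπ.map_eq] at this
    exact this.symm
  intertwines g f := by
    refine Lp.ext ?_
    have hg := (measurePreserving_smul g μ)
    have hg' := (measurePreserving_smul g lam)
    filter_upwards [coeFn_factorLift hπ (koopman μ g f), hG g,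
      hπ.quasiMeasurePreserving.ae (Lp.coeFn_compMeasurePreserving f hg),
      Lp.coeFn_compMeasurePreserving (factorLift π hπ f) hg',
      hg'.quasiMeasurePreserving.ae (coeFn_factorLift hπ f)] with z h1 h2 h3 h4 h5
    rw [h1, koopman, koopman, h4, Function.comp_apply, h3, Function.comp_apply,
      Function.comp_apply, h5, Function.comp_apply, h2]

lemma factorLift_indicatorL2 {π : Z → X} (hπ : MeasurePreserving π lam μ) {s : Set X}
    (hs : MeasurableSet s) :
    factorLift π hπ (indicatorL2 μ hs) = indicatorL2 lam (hπ.measurable hs) :=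
  Lp.indicatorConstLp_compMeasurePreserving hs _ _ hπ

/-- The entropy argument runs on the adjoint, since it needs functions on `X` built from sets in
`Y`. Once the adjoint sends `1_B` to the constant `ν B`, pairing `J f` with `1_B` determines `J f`.
-/
theorem areDisjoint_of_entropy [Countable G] {P : ℕ → Finset G} (hP : ∀ j, (P j).Nonempty)
    (hT : HasCompletelyPositivePEntropy μ P) (hS : pEntropy ν P = 0) : AreDisjoint G μ ν := by
  intro J hJ f
  refine ext_inner_indicatorL2 fun B hB => ?_
  have hK : adjoint J (indicatorL2 ν hB) = Lp.const 2 μ (ν.real B) := by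
    refine Lp.ext ?_
    filter_upwards [hJ.adjoint.isMarkovFamily.ae_eq_const hP hT hS hB,
      Lp.coeFn_const (p := 2) (μ := μ) (ν.real B)] with x h1 h2
    simp only [hB, dite_true] at h1
    rw [h1, h2]
    rfl
  rw [← adjoint_inner_left, hK, inner_const_left, real_inner_comm, inner_const_left,
    integral_indicatorL2, mul_comm]

/-- Factors isomorphic to disjoint actions are independent. -/
theorem AreDisjoint.indep (h : AreDisjoint G μ ν) {W : Type*} {𝓐 𝓑 : MeasurableSpace W}
    [MeasurableSpace W] {κ : Measure W} [IsProbabilityMeasure κ] [MulAction G W]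
    [MeasurableConstSMul G W] [SMulInvariantMeasure G W κ]
    (hA : IsFactorIsomorphicTo G 𝓐 κ ν) (hB : IsFactorIsomorphicTo G 𝓑 κ μ) :
    ProbabilityTheory.Indep 𝓐 𝓑 κ := by
  obtain ⟨-, π, hπ, hπG, hπA, -⟩ := hA
  obtain ⟨-, σ, hσ, hσG, hσB, -⟩ := hB
  rw [ProbabilityTheory.Indep_iff]
  intro s t hs ht
  obtain ⟨A, hA, hsA⟩ := hπA s hs
  obtain ⟨B, hB, htB⟩ := hσB t ht
  -- The operator of the joining of `X` and `Y` inside `W`: its matrix coefficients on indicators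
  -- are the measures of `π ⁻¹' A ∩ σ ⁻¹' B`.
  have hJ := h _ ((isMarkovIntertwining_factorLift hσ hσG).comp
    (isMarkovIntertwining_factorLift hπ hπG).adjoint) (indicatorL2 μ hB)
  have key : κ.real (π ⁻¹' A ∩ σ ⁻¹' B) = ν.real A * μ.real B := by
    rw [← L2.real_inner_indicatorConstLp_one_indicatorConstLp_one (hπ.measurable hA)
      (hσ.measurable hB), ← indicatorL2, ← indicatorL2, ← factorLift_indicatorL2 hπ hA,
      ← factorLift_indicatorL2 hσ hB, ← adjoint_inner_right, ← ContinuousLinearMap.comp_apply, hJ,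
      real_inner_comm, inner_const_left, integral_indicatorL2, integral_indicatorL2, mul_comm]
  rw [measure_congr (hsA.inter htB), measure_congr hsA, measure_congr htB,
    hπ.measure_preimage hA.nullMeasurableSet, hσ.measure_preimage hB.nullMeasurableSet,
    ← ENNReal.toReal_eq_toReal_iff' (measure_ne_top _ _)
      (ENNReal.mul_ne_top (measure_ne_top _ _) (measure_ne_top _ _)), ENNReal.toReal_mul]
  exact key

end Operators

end PEntropy

theorem mainTheorem3 {G : Type*} [Group G] [Countable G] [Infinite G]
    (P : ℕ → Finset G) (hP : ∀ j, (P j).Nonempty)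
    -- the action `T` of `G` on the standard probability space `(X, μ)`
    {X : Type*} [MeasurableSpace X] [StandardBorelSpace X] (μ : Measure X) [IsProbabilityMeasure μ]
    [MulAction G X] [MeasurableConstSMul G X] [SMulInvariantMeasure G X μ]
    -- the action `S` of `G` on the standard probability space `(Y, ν)`
    {Y : Type*} [MeasurableSpace Y] [StandardBorelSpace Y] (ν : Measure Y) [IsProbabilityMeasure ν]
    [MulAction G Y] [MeasurableConstSMul G Y] [SMulInvariantMeasure G Y ν]
    (hT : PEntropy.HasCompletelyPositivePEntropy μ P)
    (hS : PEntropy.pEntropy ν P = 0) :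
    PEntropy.AreDisjoint G μ ν ∧
    ∀ {Z : Type*} (𝓐 𝓑 : MeasurableSpace Z) [MeasurableSpace Z] [StandardBorelSpace Z]
      (lam : Measure Z) [IsProbabilityMeasure lam]
      [MulAction G Z] [MeasurableConstSMul G Z] [SMulInvariantMeasure G Z lam],
      PEntropy.IsFactorIsomorphicTo G 𝓐 lam ν → PEntropy.IsFactorIsomorphicTo G 𝓑 lam μ →
      ProbabilityTheory.Indep 𝓐 𝓑 lam := by
  have h := PEntropy.areDisjoint_of_entropy hP hT hS
  refine ⟨h, ?_⟩
  intro Z 𝓐 𝓑 _ _ lam _ _ _ _ hA hB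
  exact h.indep hA hB
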